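/- Let $\mathcal H$ be a separable complex Hilbert space. A normed ideal $\mathcal I$ of $B(\mathcal H)$ is a two-sided ideal, complete in a norm $\|\cdot\|_{\mathcal I}$ such that $\|A\|_{\mathcal I}\le\|B\|_{\mathcal I}$ for $0\le A\le B$ in $\mathcal I$, $\|B\|\le K\|B\|_{\mathcal I}$ for some $K>0$ and all $B\in\mathcal I$, and $\|SBT\|_{\mathcal I}\le\|S\|\,\|B\|_{\mathcal I}\,\|T\|$ for $B\in\mathcal I$, $S,T\in B(\mathcal H)$. Let $\tau$ be a positive trace on $\mathcal I$: a linear functional with $\tau(TA)=\tau(AT)$ for $A\in\mathcal I$, $T\in B(\mathcal H)$, with $\tau(A)\ge0$ for $0\le A\in\mathcal I$, and with $|\tau(A)|\le M\|A\|_{\mathcal I}$ for some $M>0$ and all $A\in\mathcal I$; $\|\tau\|$ is the infimum of such $M$. Let $\mathbf A=(A_1,\dots,A_n)$ and $\mathbf B=(B_1,\dots,B_n)$ be tuples of pairwise commuting contractions on $\mathcal H$ such that all $V_j=B_j-A_j$ lie in $\mathcal I$ and commute with each other. Suppose that for every $t\in[0,1]$ the tuple $\mathbf X(t)=(A_j+tV_j)_{j}$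 consists of commuting contractions and has a commuting normal contractive dilation: there are a Hilbert space $\mathcal K\supset\mathcal H$ and commuting normal contractions $U_1,\dots,U_n$ on $\mathcal K$ with $X_{j_1}(t)\cdots X_{j_l}(t)=P_{\mathcal H}U_{j_1}\cdots U_{j_l}|_{\mathcal H}$ for all $l\ge1$ and $1\le j_1,\dots,j_l\le n$. For $f(z)=\sum_k c_kz_1^{k_1}\cdots z_n^{k_n}$, absolutely convergent for $|z_j|<1+\varepsilon$, put $f(\mathbf X)=\sum_k c_kX_1^{k_1}\cdots X_n^{k_n}$. Let $\mathcal A(\mathbb D^n_{1+\varepsilon})$ be the space of functions holomorphic on the polydisc $\{|z_j|<1+\varepsilon\}$ (equivalently, given there by such a series), and $\mathcal A((-1-\varepsilon,1+\varepsilon)^n)$ the space of complex-valued functions on $(-1-\varepsilon,1+\varepsilon)^n$ given there by an absolutely convergent power series. Let $\mathbb T$ be the unit circle, and let $\|\mu\|$ denote total variation. (1) There are complex measures $\mu_1,\dots,\mu_n$ on $\Omega^n$, $\Omega=\mathbb T$, such that for every $j$ $$\|\mu_j\|\le\min\{\|\tau\|\,\|V_j\|_{\mathcal I},\ \tau(|\mathrm{Re}V_j|+|\mathrm{Im}V_j|)\},\qquad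 \mu_j(\Omega^n)=\tau(V_j),$$ where $|\mathrm{Re}V_j|+|\mathrm{Im}V_j|\in\mathcal I$, and such that for every $\varepsilon>0$ and $f\in\mathcal A(\mathbb D^n_{1+\varepsilon})$ one has $f(\mathbf B)-f(\mathbf A)\in\mathcal I$ and $$\tau(f(\mathbf B)-f(\mathbf A))=\sum_{j=1}^n\int_{\Omega^n}\frac{\partial f}{\partial z_j}\,d\mu_j .$$ Moreover, for every $j$, the image of $\mu_j$ under $z\mapsto z_j$ is a one-variable measure for $(A_j,B_j)$, and for every one-variable measure $\nu$ for $(A_j,B_j)$, every $\varepsilon>0$ and every $g\in\mathcal A(\mathbb D_{1+\varepsilon})$, $$\int_{\Omega^n}g(z_j)\,d\mu_j(z)=\int_{\Omega}g\,d\nu .$$ Here a one-variable measure for $(A_j,B_j)$ is a complex measure $\nu$ on $\mathbb T$ with $\|\nu\|\le\min\{\|\tau\|\|V_j\|_{\mathcal I},\tau(|\mathrm{Re}V_j|+|\mathrm{Im}V_j|)\}$ such that, for all $\varepsilon>0$ and $f\in\mathcal A(\mathbb D_{1+\varepsilon})$, $f(B_j)-f(A_j)\in\mathcal I$ and $\tau(f(B_j)-f(A_j))=\int_{\mathbb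 T}f'\,d\nu$. (2) If, in addition, all $A_j$ and $B_j$ are self-adjoint, then there are real-valued measures $\mu_1,\dots,\mu_n$ on $[-1,1]^n$ for which all statements of (1) hold with $\Omega=[-1,1]$, with $\mathcal A((-1-\varepsilon,1+\varepsilon)^n)$ and $\mathcal A((-1-\varepsilon,1+\varepsilon))$ in place of $\mathcal A(\mathbb D^n_{1+\varepsilon})$ and $\mathcal A(\mathbb D_{1+\varepsilon})$, and where a one-variable measure for $(A_j,B_j)$ now is a real-valued measure $\nu$ on $[-1,1]$, carried by the convex hull of $\sigma(A_j)\cup\sigma(B_j)$, such that, for all $\varepsilon>0$ and $f\in\mathcal A((-1-\varepsilon,1+\varepsilon))$, $f(B_j)-f(A_j)\in\mathcal I$ and $\tau(f(B_j)-f(A_j))=\int f'\,d\nu$. -/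

import Mathlib

open MeasureTheory
open scoped ComplexStarModule

noncomputable section

namespace OpTrace

universe u

/-! ## Normed ideals and traces -/

section Ideals

variable {H : Type u} [NormedAddCommGroup H] [InnerProductSpace ℂ H] [CompleteSpace H]

/-- A normed ideal of `B(H)`: a two-sided ideal with an ideal norm, complete in that norm.
The norm is given as a seminorm; it is definite because it dominates a positive multiple of the
operator norm (`norm_bound`). -/
structure NormedIdeal (H : Type u) [NormedAddCommGroup H] [InnerProductSpace ℂ H]
    [CompleteSpace H] where
  /-- the underlying ideal -/
  carrier : Submodule ℂ (H →L[ℂ] H)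
  mul_mem_left : ∀ (T A : H →L[ℂ] H), A ∈ carrier → T * A ∈ carrier
  mul_mem_right : ∀ (A T : H →L[ℂ] H), A ∈ carrier → A * T ∈ carrier
  /-- the ideal norm -/
  inorm : Seminorm ℂ carrier
  inorm_mono : ∀ A B : carrier, 0 ≤ (A : H →L[ℂ] H) → (A : H →L[ℂ] H) ≤ (B : H →L[ℂ] H) →
    inorm A ≤ inorm B
  norm_bound : ∃ K : ℝ, 0 < K ∧ ∀ A : carrier, ‖(A : H →L[ℂ] H)‖ ≤ K * inorm A
  inorm_mul_mul : ∀ (S T : H →L[ℂ] H) (A : carrier),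
    inorm ⟨S * A * T, mul_mem_right _ T (mul_mem_left S _ A.2)⟩ ≤ ‖S‖ * inorm A * ‖T‖
  complete : ∀ u : ℕ → carrier,
    (∀ δ : ℝ, 0 < δ → ∃ N : ℕ, ∀ m k : ℕ, N ≤ m → N ≤ k → inorm (u m - u k) < δ) →
    ∃ a : carrier, ∀ δ : ℝ, 0 < δ → ∃ N : ℕ, ∀ m : ℕ, N ≤ m → inorm (u m - a) < δ

/-- A positive trace on a normed ideal, bounded with respect to the ideal norm. -/
structure PositiveTrace (I : NormedIdeal H) where
  /-- the underlying linear functional -/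
  toFun : I.carrier →ₗ[ℂ] ℂ
  cyclic : ∀ (A : I.carrier) (T : H →L[ℂ] H),
    toFun ⟨T * A, I.mul_mem_left T _ A.2⟩ = toFun ⟨A * T, I.mul_mem_right _ T A.2⟩
  positive : ∀ A : I.carrier, 0 ≤ (A : H →L[ℂ] H) → 0 ≤ (toFun A).re ∧ (toFun A).im = 0
  bounded : ∃ M : ℝ, 0 < M ∧ ∀ A : I.carrier, ‖toFun A‖ ≤ M * I.inorm A

/-- The norm of a trace in the dual of the ideal. -/
def PositiveTrace.dualNorm {I : NormedIdeal H} (τ : PositiveTrace I) : ℝ :=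
  sInf {M : ℝ | 0 < M ∧ ∀ A : I.carrier, ‖τ.toFun A‖ ≤ M * I.inorm A}

/-- `|Re V| + |Im V|`. -/
def absReIm (V : H →L[ℂ] H) : H →L[ℂ] H :=
  CFC.abs (ℜ V : H →L[ℂ] H) + CFC.abs (ℑ V : H →L[ℂ] H)

/-- `‖ν‖ ≤ min {‖τ‖ ‖V‖_I, τ(|Re V| + |Im V|)}`, where `‖ν‖` is the total variation of `ν`; that
`|Re V| + |Im V|` lies in the ideal is part of the assertion. -/
def VariationBound {I : NormedIdeal H} (τ : PositiveTrace I) (V : I.carrier)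
    {X M : Type*} [MeasurableSpace X] [NormedAddCommGroup M] (ν : VectorMeasure X M) : Prop :=
  ∃ h : absReIm (V : H →L[ℂ] H) ∈ I.carrier,
    ν.variation Set.univ ≤
      ENNReal.ofReal (min (τ.dualNorm * I.inorm V) (τ.toFun ⟨absReIm (V : H →L[ℂ] H), h⟩).re)

end Ideals

/-! ## Tuples of contractions and their dilations -/

section Tuples

variable {H : Type u} [NormedAddCommGroup H] [InnerProductSpace ℂ H]

/-- Tuples of pairwise commuting contractions. -/
def IsCommutingContractions {n : ℕ} (X : Fin n → H →L[ℂ] H) : Prop :=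
  (∀ i, ‖X i‖ ≤ 1) ∧ ∀ i j, Commute (X i) (X j)

/-- `X` has a dilation to a tuple `U` of commuting normal contractions on a Hilbert space `K`
containing `H` (through the isometry `ι`): every word in `X` is the compression to `H` of the
same word in `U`. -/
def HasCommutingNormalDilation {H : Type u} [NormedAddCommGroup H] [InnerProductSpace ℂ H]
    [CompleteSpace H] {n : ℕ} (X : Fin n → H →L[ℂ] H) : Prop :=
  ∃ (K : Type u) (_ : NormedAddCommGroup K) (_ : InnerProductSpace ℂ K) (_ : CompleteSpace K)
    (ι : H →ₗᵢ[ℂ] K) (U : Fin n → K →L[ℂ] K),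
    IsCommutingContractions U ∧ (∀ i, IsStarNormal (U i)) ∧
    ∀ w : List (Fin n), w ≠ [] →
      (w.map X).prod =
        (ContinuousLinearMap.adjoint ι.toContinuousLinearMap).comp
          ((w.map U).prod.comp ι.toContinuousLinearMap)

/-- The point with parameter `t` on the linear path from `A` to `B`. -/
def linePath {n : ℕ} (A B : Fin n → H →L[ℂ] H) (t : ℝ) : Fin n → H →L[ℂ] H :=
  fun j => A j + (t : ℂ) • (B j - A j)

/-- The linear path from `A` to `B` consists of tuples of commuting contractions that admit a
dilation to a tuple of commuting normal contractions. -/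
def PathDilates {H : Type u} [NormedAddCommGroup H] [InnerProductSpace ℂ H]
    [CompleteSpace H] {n : ℕ} (A B : Fin n → H →L[ℂ] H) : Prop :=
  ∀ t ∈ Set.Icc (0 : ℝ) 1,
    IsCommutingContractions (linePath A B t) ∧ HasCommutingNormalDilation (linePath A B t)

end Tuples

/-! ## Functions given by power series -/

section Functions

/-- `f` belongs to the space of functions holomorphic on the polydisc `|z_j| < 1 + ε` (for `𝕜 = ℂ`),
respectively of functions on `(-1-ε, 1+ε)^n` represented there by their Taylor series (for
`𝕜 = ℝ`), and `c` is the family of its Taylor coefficients. The convergence is unconditional, hence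
absolute. -/
def HasTaylor {𝕜 : Type*} [NormedField 𝕜] [NormedAlgebra 𝕜 ℂ] {n : ℕ} (ε : ℝ) (f : (Fin n → 𝕜) → ℂ)
    (c : (Fin n → ℕ) → ℂ) : Prop :=
  ∀ z : Fin n → 𝕜, (∀ i, ‖z i‖ < 1 + ε) →
    HasSum (fun k : Fin n → ℕ => c k * algebraMap 𝕜 ℂ (∏ i, z i ^ k i)) (f z)

/-- The one-variable version of `HasTaylor`. -/
def HasTaylorOne {𝕜 : Type*} [NormedField 𝕜] [NormedAlgebra 𝕜 ℂ] (ε : ℝ) (f : 𝕜 → ℂ)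
    (c : ℕ → ℂ) : Prop :=
  ∀ z : 𝕜, ‖z‖ < 1 + ε → HasSum (fun k : ℕ => c k * algebraMap 𝕜 ℂ (z ^ k)) (f z)

/-- The partial derivative `∂f/∂z_j` at `z`. -/
def partialD {𝕜 : Type*} [NontriviallyNormedField 𝕜] [NormedSpace 𝕜 ℂ] {n : ℕ} (j : Fin n)
    (f : (Fin n → 𝕜) → ℂ) (z : Fin n → 𝕜) : ℂ :=
  deriv (fun w : 𝕜 => f (Function.update z j w)) (z j)

variable {H : Type u} [NormedAddCommGroup H] [InnerProductSpace ℂ H]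

/-- `f(X_1, …, X_n) = ∑ c_k X_1^{k_1} ⋯ X_n^{k_n}`, for `f` with Taylor coefficients `c`. -/
def opFun {n : ℕ} (c : (Fin n → ℕ) → ℂ) (X : Fin n → H →L[ℂ] H) : H →L[ℂ] H :=
  ∑' k : Fin n → ℕ, c k • (List.ofFn fun i => X i ^ k i).prod

/-- `f(X) = ∑ c_k X^k`, for `f` with Taylor coefficients `c`. -/
def opFunOne (c : ℕ → ℂ) (X : H →L[ℂ] H) : H →L[ℂ] H :=
  ∑' k : ℕ, c k • X ^ k

end Functions

/-! ## One-variable measures -/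

section OneVariable

variable {H : Type u} [NormedAddCommGroup H] [InnerProductSpace ℂ H] [CompleteSpace H]

/-- The unit circle. -/
abbrev UnitCircle : Type := ↥(Metric.sphere (0 : ℂ) 1)

/-- The interval `[-1, 1]`. -/
abbrev UnitInterval : Type := ↥(Set.Icc (-1 : ℝ) 1)

/-- `ν` is a measure on the circle for the one-variable trace formula for the pair of contractions
`(A, B)`: it satisfies the norm estimate and `τ(f(B) - f(A)) = ∫ f' dν` for every `f` holomorphic
on a disc of radius greater than one. -/
def IsCircleMeasureFor {I : NormedIdeal H} (τ : PositiveTrace I) (A B : H →L[ℂ] H)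
    (hV : B - A ∈ I.carrier) (ν : ComplexMeasure UnitCircle) : Prop :=
  VariationBound τ ⟨B - A, hV⟩ ν ∧
  ∀ ε : ℝ, 0 < ε → ∀ (f : ℂ → ℂ) (c : ℕ → ℂ), HasTaylorOne ε f c →
    ∃ h : opFunOne c B - opFunOne c A ∈ I.carrier,
      τ.toFun ⟨opFunOne c B - opFunOne c A, h⟩ =
        ∫ᵛ z, deriv f (z : ℂ) ∂[ContinuousLinearMap.mul ℝ ℂ; ν]

/-- `ν` is the real measure of the one-variable trace formula for the pair of self-adjoint
contractions `(A, B)`: it is carried by the convex hull of `σ(A) ∪ σ(B)` and satisfies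
`τ(f(B) - f(A)) = ∫ f' dν` for every `f` represented by its Taylor series on some
`(-1-ε, 1+ε)`. (As polynomials are dense in `C[-1,1]`, there is at most one such measure.) -/
def IsIntervalMeasureFor {I : NormedIdeal H} (τ : PositiveTrace I) (A B : H →L[ℂ] H)
    (ν : SignedMeasure UnitInterval) : Prop :=
  ν.variation {x | (x : ℝ) ∉ convexHull ℝ (spectrum ℝ A ∪ spectrum ℝ B)} = 0 ∧
  ∀ ε : ℝ, 0 < ε → ∀ (f : ℝ → ℂ) (c : ℕ → ℂ), HasTaylorOne ε f c →
    ∃ h : opFunOne c B - opFunOne c A ∈ I.carrier,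
      τ.toFun ⟨opFunOne c B - opFunOne c A, h⟩ =
        ∫ᵛ x, deriv f (x : ℝ) ∂<•ν

end OneVariable

end OpTrace

end

/-! Put X(t) = A + tV. Each tuple X(t) is commutative, so cyclicity of the trace brings every
increment V_j to the front of a product, and a polynomial p satisfies d/dt τ(p(X(t)) - p(A)) = ∑_j
τ(V_j (∂_j p)(X(t))). Integration over [0,1] gives τ(p(B) - p(A)) = ∑_j Λ_j(∂_j p), where Λ_j(p) =
∫₀¹ τ(V_j p(X(t))) dt (`pathFunctional`, `ext_monoProd_sub_eq`).

Two estimates make Λ_j a bounded functional for the sup norm. The trace satisfies |τ(VT)| ≤ min{‖τ‖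
‖V‖_I, τ(|Re V| + |Im V|)} ‖T‖ (`norm_ext_mul_le_varBound`), by polar decomposition and
Cauchy–Schwarz. Von Neumann's inequality bounds ‖p(X(t))‖ by the supremum of |p| on the torus
(`HasCommutingNormalDilation.norm_polyEval_le`), or, for self-adjoint tuples, on the product of the
convex hulls of the spectra (`norm_polyEval_linePath_le_of_isSelfAdjoint`). Hahn–Banach and Riesz
representation then produce μ_j with the required variation, and μ_j has total mass Λ_j(1) = τ(V_j).

Power series are reached through `opFun_sub_mem_and_hasSum`: the differences B^k - A^k have ideal
norm O(|k|), so f(B) - f(A) converges in the ideal. Functions of z_j alone turn the formula into the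
one-variable formula for the j-th marginal; since every g is a derivative, that formula fixes all
integrals of g(z_j). -/

noncomputable section

namespace OpTrace

/-! ### Riesz representation on C(X) with control of the total variation. -/

section Riesz

open scoped NNReal ENNReal CompactlySupported

variable {𝕜 : Type*} [RCLike 𝕜] {X : Type*} [TopologicalSpace X] [CompactSpace X]

/-- The total variation of a bounded functional on `C(X)`, evaluated at a nonnegative function. -/
def absFunctional (φ : C(X, 𝕜) →L[𝕜] 𝕜) (f : X → ℝ≥0) : ℝ≥0 :=
  ⨆ g : {g : C(X, 𝕜) // ∀ x, ‖g x‖₊ ≤ f x}, ‖φ g‖₊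

lemma absFunctional_bddAbove (φ : C(X, 𝕜) →L[𝕜] 𝕜) {f : X → ℝ≥0} (hf : Continuous f) :
    BddAbove (Set.range fun g : {g : C(X, 𝕜) // ∀ x, ‖g x‖₊ ≤ f x} => ‖φ g‖₊) := by
  obtain ⟨M, hM⟩ := (isCompact_range hf).bddAbove
  refine ⟨‖φ‖₊ * M, ?_⟩
  rintro _ ⟨g, rfl⟩
  refine (φ.le_opNNNorm g).trans ?_
  gcongr
  exact (ContinuousMap.norm_le _ M.2).2 fun x => (g.2 x).trans (hM ⟨x, rfl⟩)

lemma le_absFunctional (φ : C(X, 𝕜) →L[𝕜] 𝕜) {f : X → ℝ≥0} (hf : Continuous f) {g : C(X, 𝕜)}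
    (hg : ∀ x, ‖g x‖₊ ≤ f x) : ‖φ g‖₊ ≤ absFunctional φ f :=
  le_ciSup (absFunctional_bddAbove φ hf) ⟨g, hg⟩

omit [CompactSpace X] in
lemma absFunctional_le (φ : C(X, 𝕜) →L[𝕜] 𝕜) {f : X → ℝ≥0} {M : ℝ≥0}
    (h : ∀ g : C(X, 𝕜), (∀ x, ‖g x‖₊ ≤ f x) → ‖φ g‖₊ ≤ M) : absFunctional φ f ≤ M := by
  have : Nonempty {g : C(X, 𝕜) // ∀ x, ‖g x‖₊ ≤ f x} := ⟨0, by simp⟩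
  exact ciSup_le fun g => h g g.2

lemma absFunctional_smul_le (φ : C(X, 𝕜) →L[𝕜] 𝕜) {f : X → ℝ≥0} (hf : Continuous f) (c : ℝ≥0) :
    c * absFunctional φ f ≤ absFunctional φ (fun x => c * f x) := by
  rcases eq_or_ne c 0 with rfl | hc
  · simp
  rw [← le_inv_mul_iff₀ (pos_iff_ne_zero.2 hc)]
  refine absFunctional_le φ fun g hg => ?_
  rw [le_inv_mul_iff₀ (pos_iff_ne_zero.2 hc)]
  have := le_absFunctional φ (f := fun x => c * f x) (by fun_prop) (g := ((c : ℝ) : 𝕜) • g)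
    (fun x => by simpa [nnnorm_smul] using by gcongr; exact hg x)
  simpa [nnnorm_smul] using this

lemma absFunctional_smul (φ : C(X, 𝕜) →L[𝕜] 𝕜) {f : X → ℝ≥0} (hf : Continuous f) (c : ℝ≥0) :
    absFunctional φ (fun x => c * f x) = c * absFunctional φ f := by
  rcases eq_or_ne c 0 with rfl | hc
  · refine le_antisymm (absFunctional_le φ fun g hg => ?_) (by simp)
    have : g = 0 := by ext x; simpa using hg x
    simp [this]
  refine le_antisymm ?_ (absFunctional_smul_le φ hf c)
  have := absFunctional_smul_le φ (f := fun x => c * f x) (by fun_prop) c⁻¹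
  simp only [inv_mul_cancel_left₀ hc] at this
  rwa [inv_mul_le_iff₀ (pos_iff_ne_zero.2 hc)] at this

lemma exists_norm_one_mul_eq_norm (z : 𝕜) : ∃ u : 𝕜, ‖u‖₊ = 1 ∧ u * z = (‖z‖ : 𝕜) := by
  rcases eq_or_ne z 0 with rfl | hz
  · exact ⟨1, by simp⟩
  · have h : (‖z‖ : 𝕜) ≠ 0 := by simpa using hz
    refine ⟨(‖z‖ : 𝕜) / z, ?_, by field_simp⟩
    rw [nnnorm_div, div_eq_one_iff_eq (by simpa using hz)]
    ext; simp

/-- A function dominated by f₁ + f₂ splits proportionally into pieces dominated by f₁ and f₂, which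
gives subadditivity. Conversely, unimodular factors make the values of φ on two competitors
nonnegative, so their norms add. -/
lemma absFunctional_add (φ : C(X, 𝕜) →L[𝕜] 𝕜) {f₁ f₂ : X → ℝ≥0} (h₁ : Continuous f₁)
    (h₂ : Continuous f₂) :
    absFunctional φ (fun x => f₁ x + f₂ x) = absFunctional φ f₁ + absFunctional φ f₂ := by
  apply le_antisymm
  · refine absFunctional_le φ fun g hg => ?_
    have key : ∀ δ : ℝ≥0, 0 < δ →
        ‖φ g‖₊ ≤ absFunctional φ f₁ + absFunctional φ f₂ + ‖φ‖₊ * δ := by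
      intro δ hδ
      have hpos : ∀ x, f₁ x + f₂ x + δ ≠ 0 := fun x => by positivity
      have hposR : ∀ x, ((f₁ x : ℝ) + f₂ x + δ) ≠ 0 := fun x => by positivity
      -- The term δ keeps the denominator away from zero where f₁ + f₂ vanishes; the leftover piece
      -- `q δ` costs at most ‖φ‖ δ.
      let q (a : C(X, ℝ≥0)) : C(X, 𝕜) :=
        ⟨fun x => ((((a x : ℝ≥0) : ℝ) / ((f₁ x : ℝ) + f₂ x + δ) : ℝ) : 𝕜) * g x, by
          refine Continuous.mul (RCLike.continuous_ofReal.comp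
            (Continuous.div (by fun_prop) (by fun_prop) hposR)) g.continuous⟩
      have hq : ∀ a x, ‖q a x‖₊ ≤ a x := by
        intro a x
        have h : ‖q a x‖₊ = a x / (f₁ x + f₂ x + δ) * ‖g x‖₊ := by
          ext
          simp only [q, ContinuousMap.coe_mk, coe_nnnorm, norm_mul, RCLike.norm_ofReal,
            NNReal.coe_mul, NNReal.coe_div, NNReal.coe_add]
          rw [abs_of_nonneg (by positivity)]
        rw [h, div_mul_eq_mul_div, div_le_iff₀ (pos_iff_ne_zero.2 (hpos x))]
        gcongr
        exact (hg x).trans le_self_add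
      have hsum : g = q ⟨f₁, h₁⟩ + q ⟨f₂, h₂⟩ + q (ContinuousMap.const X δ) := by
        ext x
        have : ((f₁ x : ℝ) : 𝕜) + ((f₂ x : ℝ) : 𝕜) + ((δ : ℝ) : 𝕜) ≠ 0 := by
          exact_mod_cast hposR x
        simp only [q, ContinuousMap.add_apply, ContinuousMap.coe_mk, ContinuousMap.const_apply]
        push_cast
        field_simp
      rw [hsum, map_add, map_add]
      refine (nnnorm_add_le _ _).trans (add_le_add ((nnnorm_add_le _ _).trans (add_le_add
        (le_absFunctional φ h₁ (hq _)) (le_absFunctional φ h₂ (hq _)))) ?_)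
      refine (φ.le_opNNNorm _).trans ?_
      gcongr
      exact (ContinuousMap.norm_le _ δ.2).2 (hq _)
    refine le_of_forall_pos_le_add fun ε hε => ?_
    refine (key (ε / (‖φ‖₊ + 1)) (by positivity)).trans ?_
    gcongr
    rw [mul_div_assoc', div_le_iff₀ (by positivity), mul_comm]
    gcongr
    simp
  · have : ∀ g₁ : C(X, 𝕜), (∀ x, ‖g₁ x‖₊ ≤ f₁ x) → ∀ g₂ : C(X, 𝕜), (∀ x, ‖g₂ x‖₊ ≤ f₂ x) →
        ‖φ g₁‖₊ + ‖φ g₂‖₊ ≤ absFunctional φ (fun x => f₁ x + f₂ x) := by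
      intro g₁ hg₁ g₂ hg₂
      obtain ⟨u₁, hu₁, e₁⟩ := exists_norm_one_mul_eq_norm (φ g₁)
      obtain ⟨u₂, hu₂, e₂⟩ := exists_norm_one_mul_eq_norm (φ g₂)
      refine le_trans (le_of_eq ?_) (le_absFunctional φ (f := fun x => f₁ x + f₂ x)
        (by fun_prop) (g := u₁ • g₁ + u₂ • g₂) fun x => ?_)
      · rw [map_add, map_smul, map_smul, smul_eq_mul, smul_eq_mul, e₁, e₂, ← RCLike.ofReal_add]
        ext
        rw [coe_nnnorm, RCLike.norm_ofReal, abs_of_nonneg (by positivity)]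
        simp
      · refine (nnnorm_add_le _ _).trans (add_le_add ?_ ?_)
        · simpa [hu₁] using hg₁ x
        · simpa [hu₂] using hg₂ x
    by_contra! hlt
    set M := absFunctional φ (fun x => f₁ x + f₂ x) with hM
    have h1 : absFunctional φ f₁ ≤ M - absFunctional φ f₂ := by
      refine absFunctional_le φ fun g₁ hg₁ => ?_
      have h2 : absFunctional φ f₂ ≤ M - ‖φ g₁‖₊ :=
        absFunctional_le φ fun g₂ hg₂ => le_tsub_of_add_le_left (this g₁ hg₁ g₂ hg₂)
      have h0 : ‖φ g₁‖₊ ≤ M := by simpa using this g₁ hg₁ 0 (by simp)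
      have := add_le_of_le_tsub_left_of_le h0 h2
      exact le_tsub_of_add_le_right this
    have h2 : absFunctional φ f₂ ≤ M :=
      absFunctional_le φ fun g₂ hg₂ => by simpa using this 0 (by simp) g₂ hg₂
    exact absurd (add_le_of_le_tsub_right_of_le h2 h1) (not_le.2 hlt)

/-- The total variation of a bounded functional on `C(X)`, as a linear map. -/
def absLinear (φ : C(X, 𝕜) →L[𝕜] 𝕜) : C_c(X, ℝ≥0) →ₗ[ℝ≥0] ℝ≥0 where
  toFun f := absFunctional φ f
  map_add' f g := absFunctional_add φ f.continuous g.continuous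
  map_smul' c f := absFunctional_smul φ f.continuous c

/-- The bound forces Φ to vanish on the kernel of S, so Φ descends to a bounded functional on the
range of S, and Hahn–Banach extends it without increasing the bound. It serves both for C(X) → L²
and for polynomials → C(Y). -/
lemma exists_dual_comp_eq {E F : Type*} [AddCommGroup E] [Module 𝕜 E] [NormedAddCommGroup F]
    [NormedSpace 𝕜 F] (S : E →ₗ[𝕜] F) (Φ : E →ₗ[𝕜] 𝕜) {c : ℝ} (hc : 0 ≤ c)
    (h : ∀ p, ‖Φ p‖ ≤ c * ‖S p‖) :
    ∃ φ : F →L[𝕜] 𝕜, (∀ p, φ (S p) = Φ p) ∧ ‖φ‖ ≤ c := by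
  have hker : LinearMap.ker S ≤ LinearMap.ker Φ := fun p hp => by
    simpa [LinearMap.mem_ker.1 hp] using h p
  let ψ : LinearMap.range S →ₗ[𝕜] 𝕜 :=
    ((LinearMap.ker S).liftQ Φ hker).comp S.quotKerEquivRange.symm.toLinearMap
  have hψ : ∀ p, ψ (S.rangeRestrict p) = Φ p := fun p => by
    have : S.quotKerEquivRange.symm (S.rangeRestrict p) = (LinearMap.ker S).mkQ p := by
      rw [LinearEquiv.symm_apply_eq]
      ext
      simp [LinearMap.quotKerEquivRange_apply_mk]
    simp [ψ, this]
  have hb : ∀ y, ‖ψ y‖ ≤ c * ‖y‖ := by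
    rintro ⟨_, p, rfl⟩
    exact (congrArg norm (hψ p)).trans_le (h p)
  obtain ⟨φ, h1, h2⟩ := exists_extension_norm_eq _ (ψ.mkContinuous c hb)
  refine ⟨φ, fun p => ?_, h2.trans_le (ψ.mkContinuous_norm_le hc hb)⟩
  exact (h1 (S.rangeRestrict p)).trans (hψ p)

variable [T2Space X] [MeasurableSpace X] [BorelSpace X]

/-- The measure is the Riesz–Markov measure of |φ|; its mass is |φ|(1), at most ‖φ‖. -/
lemma exists_dominating_measure (φ : C(X, 𝕜) →L[𝕜] 𝕜) :
    ∃ m : Measure X, IsFiniteMeasure m ∧ m.Regular ∧ m Set.univ ≤ ENNReal.ofReal ‖φ‖ ∧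
      ∀ g : C(X, 𝕜), ‖φ g‖ ≤ ∫ x, ‖g x‖ ∂m := by
  let m := NNRealRMK.rieszMeasure (absLinear φ)
  have hm : m.Regular := inferInstance
  have hfin : IsFiniteMeasure m := ⟨isCompact_univ.measure_lt_top⟩
  refine ⟨m, hfin, hm, ?_, fun g => ?_⟩
  · have h1 := NNRealRMK.lintegral_rieszMeasure (absLinear φ)
      ⟨ContinuousMap.const X 1, HasCompactSupport.of_compactSpace _⟩
    have h2 : absLinear φ ⟨ContinuousMap.const X 1, HasCompactSupport.of_compactSpace _⟩
        ≤ ‖φ‖₊ := by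
      refine absFunctional_le φ fun g hg => (φ.le_opNNNorm g).trans ?_
      refine mul_le_of_le_one_right zero_le ?_
      exact (ContinuousMap.norm_le _ zero_le_one).2 fun x => hg x
    have h3 : m Set.univ = (absLinear φ ⟨ContinuousMap.const X 1, HasCompactSupport.of_compactSpace _⟩ : ℝ≥0) := by
      rw [← h1]
      simp [m]
    rw [h3, ofReal_norm]
    exact_mod_cast h2
  · have h1 := NNRealRMK.integral_rieszMeasure (absLinear φ)
      ⟨⟨fun x => ‖g x‖₊, by fun_prop⟩, HasCompactSupport.of_compactSpace _⟩
    have h2 : ‖φ g‖₊ ≤ absLinear φ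
        ⟨⟨fun x => ‖g x‖₊, by fun_prop⟩, HasCompactSupport.of_compactSpace _⟩ :=
      le_absFunctional φ (f := fun x => ‖g x‖₊) (by fun_prop) fun x => le_rfl
    refine (NNReal.coe_le_coe.2 h2).trans (le_of_eq ?_)
    rw [← h1]
    rfl

omit [TopologicalSpace X] [CompactSpace X] [T2Space X] [BorelSpace X] in
lemma exists_integral_norm_le_mul_norm_Lp_two (m : Measure X) [IsFiniteMeasure m] :
    ∃ C : ℝ, 0 ≤ C ∧ ∀ u : Lp 𝕜 2 m, ∫ x, ‖u x‖ ∂m ≤ C * ‖u‖ := by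
  refine ⟨((m Set.univ) ^ (1 / 2 : ℝ)).toReal, ENNReal.toReal_nonneg, fun u => ?_⟩
  have h1 := eLpNorm_le_eLpNorm_mul_rpow_measure_univ (μ := m) (p := 1) (q := 2)
    (by norm_num) (Lp.aestronglyMeasurable u)
  rw [eLpNorm_one_eq_lintegral_enorm] at h1
  rw [integral_norm_eq_lintegral_enorm (Lp.aestronglyMeasurable u), Lp.norm_def, mul_comm,
    ← ENNReal.toReal_mul]
  refine ENNReal.toReal_mono (ENNReal.mul_ne_top (Lp.eLpNorm_ne_top u) (by finiteness)) ?_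
  norm_num at h1 ⊢
  exact h1

/-- **Riesz representation** of a bounded functional on `C(X)` by a measure with density. -/
theorem exists_density_of_dual (φ : C(X, 𝕜) →L[𝕜] 𝕜) :
    ∃ (m : Measure X) (d : X → 𝕜), IsFiniteMeasure m ∧ Integrable d m ∧
      (m.withDensityᵥ d).variation Set.univ ≤ ENNReal.ofReal ‖φ‖ ∧
      ∀ g : C(X, 𝕜), ∫ x, g x * d x ∂m = φ g := by
  obtain ⟨m, hfin, hreg, hm, hφ⟩ := exists_dominating_measure φ
  obtain ⟨C, hC0, hC⟩ := exists_integral_norm_le_mul_norm_Lp_two (𝕜 := 𝕜) m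
  let S : C(X, 𝕜) →L[𝕜] Lp 𝕜 2 m := ContinuousMap.toLp 2 m 𝕜
  have hS : ∀ g : C(X, 𝕜), S g =ᵐ[m] g := fun g => ContinuousMap.coeFn_toLp m g
  have hint : ∀ u : Lp 𝕜 2 m, Integrable u m := fun u =>
    (Lp.memLp u).integrable (by norm_num)
  have hSint : ∀ g : C(X, 𝕜), ∫ x, ‖S g x‖ ∂m = ∫ x, ‖g x‖ ∂m := fun g =>
    integral_congr_ae ((hS g).fun_comp norm)
  -- Since m is finite, the L¹(m) bound on φ implies an L²(m) bound, so the density comes from the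
  -- self-duality of L².
  obtain ⟨F, hF, -⟩ := exists_dual_comp_eq S.toLinearMap φ.toLinearMap hC0 fun g =>
    (hφ g).trans ((hSint g).symm.trans_le (hC _))
  -- The sharp L¹ bound passes from continuous functions to all of L² by density. Applied to the
  -- indicator of E it reads |∫_E d dm| ≤ m(E), which bounds the variation by m.
  have hF1 : ∀ u : Lp 𝕜 2 m, ‖F u‖ ≤ ∫ x, ‖u x‖ ∂m := by
    intro u
    refine le_of_forall_pos_le_add fun ε hε => ?_
    have hd : DenseRange S := ContinuousMap.toLp_denseRange 𝕜 m 𝕜 (by norm_num)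
    obtain ⟨g, hg⟩ := hd.exists_dist_lt u (ε := ε / (‖F‖ + C + 1)) (by positivity)
    rw [dist_eq_norm] at hg
    have e1 : ‖F u‖ ≤ ‖F (u - S g)‖ + ‖φ g‖ := by
      have : F u = F (u - S g) + φ g := by
        rw [map_sub, show φ g = F (S g) from (hF g).symm]; ring
      rw [this]; exact norm_add_le _ _
    have e2 : ∫ x, ‖g x‖ ∂m ≤ (∫ x, ‖u x‖ ∂m) + ∫ x, ‖(u - S g : Lp 𝕜 2 m) x‖ ∂m := by
      rw [← hSint, ← integral_add (hint u).norm (hint _).norm]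
      refine integral_mono_ae (hint _).norm ((hint u).norm.add (hint _).norm) ?_
      filter_upwards [Lp.coeFn_sub u (S g)] with x hx
      rw [hx, Pi.sub_apply]
      have := norm_sub_le (u x) (u x - S g x)
      simpa using this
    have e3 : (‖F‖ + C) * ‖u - S g‖ ≤ ε := by
      rw [lt_div_iff₀ (by positivity)] at hg
      nlinarith [norm_nonneg (u - S g)]
    have e4 := F.le_opNorm (u - S g)
    have e5 := hC (u - S g)
    have e6 := hφ g
    linarith
  let h : Lp 𝕜 2 m := (InnerProductSpace.toDual 𝕜 (Lp 𝕜 2 m)).symm F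
  have hh : ∀ u : Lp 𝕜 2 m, F u = ∫ x, u x * star (h x) ∂m := fun u => by
    rw [← InnerProductSpace.toDual_symm_apply (𝕜 := 𝕜), L2.inner_def]
    rfl
  have hd : Integrable (fun x => star (h x)) m :=
    (hint h).mono (continuous_star.comp_aestronglyMeasurable (hint h).1) (by simp)
  refine ⟨m, fun x => star (h x), hfin, hd, ?_, fun g => ?_⟩
  · refine (VectorMeasure.variation_le_of_forall_enorm_le (m := m) (fun E hE => ?_) _).trans hm
    rw [withDensityᵥ_apply hd hE, ← ofReal_norm, ENNReal.ofReal_le_iff_le_toReal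
      (by finiteness)]
    have h1 := hF1 (indicatorConstLp 2 hE (by finiteness) (1 : 𝕜))
    have h0 : (indicatorConstLp 2 hE (by finiteness) (1 : 𝕜) : Lp 𝕜 2 m) =ᵐ[m]
      E.indicator fun _ => (1 : 𝕜) := indicatorConstLp_coeFn
    have e0 := integral_congr_ae (h0.mul (Filter.EventuallyEq.refl _ fun x => star (h x)))
    simp only [Pi.mul_apply] at e0
    have e3 := integral_congr_ae (h0.fun_comp norm)
    simp only [Function.comp_apply] at e3
    rw [hh, e0, e3] at h1
    have e1 : ∫ x in E, star (h x) ∂m = ∫ x, E.indicator (fun _ => (1 : 𝕜)) x * star (h x) ∂m := by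
      rw [← integral_indicator hE]
      congr 1; ext x
      by_cases hx : x ∈ E <;> simp [hx]
    have e2 : ∫ x, ‖E.indicator (fun _ => (1 : 𝕜)) x‖ ∂m = (m E).toReal := by
      simp_rw [norm_indicator_eq_indicator_norm]
      rw [integral_indicator hE]
      simp [Measure.real]
    rw [e1, ← e2]
    exact h1
  · rw [show φ g = F (S g) from (hF g).symm, hh]
    exact integral_congr_ae ((hS g).symm.mul (Filter.EventuallyEq.refl _ _))

end Riesz

/-! ### Integration against a vector measure with density. -/

section DensityIntegral

variable {X E F G : Type*} [MeasurableSpace X] [NormedAddCommGroup E] [NormedSpace ℝ E]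
  [NormedAddCommGroup F] [NormedSpace ℝ F] [NormedAddCommGroup G] [NormedSpace ℝ G]

lemma integrable_apply_density {m : Measure X} {d : X → F} (hd : Integrable d m)
    (B : E →L[ℝ] F →L[ℝ] G) {f : X → E} (hf : StronglyMeasurable f) {C : ℝ}
    (hC : ∀ x, ‖f x‖ ≤ C) : Integrable (fun x => B (f x) (d x)) m := by
  refine (hd.norm.const_mul (‖B‖ * C)).mono'
    (B.aestronglyMeasurable_comp₂ hf.aestronglyMeasurable hd.aestronglyMeasurable) ?_
  filter_upwards with x
  refine (B.le_opNorm₂ _ _).trans ?_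
  gcongr
  exact hC x

/-- Integration of a bounded function against a vector measure with a density. -/
theorem integral_withDensityᵥ [CompleteSpace F] [CompleteSpace G] {m : Measure X} {d : X → F}
    (hd : Integrable d m) [IsFiniteMeasure (m.withDensityᵥ d).variation]
    (B : E →L[ℝ] F →L[ℝ] G) {f : X → E} (hf : StronglyMeasurable f) {C : ℝ}
    (hC : ∀ x, ‖f x‖ ≤ C) :
    VectorMeasure.integral (m.withDensityᵥ d) f B = ∫ x, B (f x) (d x) ∂m := by
  have hbdd : ∀ g : SimpleFunc X E, ∃ C, ∀ x, ‖g x‖ ≤ C := fun g => g.exists_forall_norm_le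
  have hsimple : ∀ g : SimpleFunc X E,
      VectorMeasure.integral (m.withDensityᵥ d) g B = ∫ x, B (g x) (d x) ∂m := by
    intro g
    induction g using SimpleFunc.induction with
    | const c hs =>
      rename_i s
      have h1 : ∀ x, B (s.indicator (fun _ => c) x) (d x) = s.indicator (fun x => B c (d x)) x := by
        intro x
        by_cases hx : x ∈ s <;> simp [hx]
      have h2 : ⇑(SimpleFunc.piecewise s hs (SimpleFunc.const X c) (SimpleFunc.const X 0)) =
          s.indicator fun _ => c := by
        ext x
        by_cases hx : x ∈ s <;> simp [hx]
      rw [h2]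
      simp_rw [h1]
      rw [VectorMeasure.integral_indicator hs, integral_indicator hs,
        VectorMeasure.integral_const, ContinuousLinearMap.integral_comp_comm _ hd.integrableOn,
        VectorMeasure.restrict_apply _ hs MeasurableSet.univ, Set.univ_inter,
        withDensityᵥ_apply hd hs]
    | add _ hf hg =>
      rename_i f g _
      obtain ⟨C₁, h₁⟩ := hbdd f
      obtain ⟨C₂, h₂⟩ := hbdd g
      rw [SimpleFunc.coe_add, VectorMeasure.integral_add
        (SimpleFunc.integrable_of_isFiniteMeasure f) (SimpleFunc.integrable_of_isFiniteMeasure g), hf, hg, ← integral_add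
        (integrable_apply_density hd B f.stronglyMeasurable h₁)
        (integrable_apply_density hd B g.stronglyMeasurable h₂)]
      simp
  have hb : ∀ n x, ‖hf.approxBounded C n x‖ ≤ C := fun n x =>
    hf.norm_approxBounded_le ((norm_nonneg _).trans (hC x)) n x
  have hlim : ∀ x, Filter.Tendsto (fun n => hf.approxBounded C n x) Filter.atTop (nhds (f x)) :=
    fun x => hf.tendsto_approxBounded_of_norm_le (hC x)
  refine tendsto_nhds_unique (VectorMeasure.tendsto_integral_of_dominated_convergence (fun _ => C)
    (fun n => (hf.approxBounded C n).aestronglyMeasurable) (integrable_const _)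
    (fun n => .of_forall (hb n)) (.of_forall hlim)) ?_
  simp_rw [hsimple]
  refine tendsto_integral_of_dominated_convergence (fun x => ‖B‖ * C * ‖d x‖)
    (fun n => (integrable_apply_density hd B (hf.approxBounded C n).stronglyMeasurable
      (hb n)).aestronglyMeasurable) (hd.norm.const_mul _) (fun n => .of_forall fun x => ?_)
    (.of_forall fun x => ?_)
  · refine (B.le_opNorm₂ _ _).trans ?_
    gcongr
    exact hb n x
  · exact (((B.flip (d x)).continuous.tendsto _).comp (hlim x))

end DensityIntegral

end OpTrace
end

noncomputable section

namespace OpTrace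

/-! ### Normed ideals and the trace estimate. -/

section OperatorIdeals

variable {H : Type*} [NormedAddCommGroup H] [InnerProductSpace ℂ H] [CompleteSpace H]

/-- Douglas' factorization lemma. -/
lemma exists_contraction_mul_eq {A B : H →L[ℂ] H} (h : ∀ x, ‖A x‖ ≤ ‖B x‖) :
    ∃ C : H →L[ℂ] H, ‖C‖ ≤ 1 ∧ A = C * B := by
  let M : Submodule ℂ H := (LinearMap.range B.toLinearMap).topologicalClosure
  have : CompleteSpace M := (Submodule.isClosed_topologicalClosure _).completeSpace_coe
  have hmem : ∀ x, B x ∈ M := fun x => Submodule.le_topologicalClosure _ ⟨x, rfl⟩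
  let e : H →ₗ[ℂ] M := B.toLinearMap.codRestrict M hmem
  have hd : DenseRange e := by
    intro y
    rw [Metric.mem_closure_range_iff]
    intro ε hε
    obtain ⟨_, ⟨x, rfl⟩, hx⟩ := Metric.mem_closure_iff.1 y.2 ε hε
    exact ⟨x, hx⟩
  have hn : ∀ x, ‖A.toLinearMap x‖ ≤ 1 * ‖e x‖ := fun x => by simpa [e] using h x
  -- C extends the contraction Bx ↦ Ax to the closure of the range of B and is zero on the
  -- orthogonal complement.
  refine ⟨(A.toLinearMap.extendOfNorm e).comp M.orthogonalProjectionOnto, ?_, ?_⟩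
  · refine (ContinuousLinearMap.opNorm_comp_le _ _).trans ?_
    exact mul_le_one₀ (LinearMap.opNorm_extendOfNorm_le hd zero_le_one hn) (norm_nonneg _)
      M.orthogonalProjectionOnto_norm_le
  · ext x
    have : M.orthogonalProjectionOnto (B x) = e x :=
      Submodule.orthogonalProjectionOnto_mem_subspace_eq_self (e x)
    simp only [mul_apply_eq_comp, ContinuousLinearMap.comp_apply, this]
    exact (LinearMap.extendOfNorm_eq hd ⟨1, hn⟩ x).symm

lemma norm_abs_apply (A : H →L[ℂ] H) (x : H) : ‖CFC.abs A x‖ = ‖A x‖ := by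
  have h1 : ∀ B : H →L[ℂ] H, ‖B x‖ ^ 2 = RCLike.re (inner ℂ ((star B * B) x) x) := fun B => by
    rw [ContinuousLinearMap.apply_norm_sq_eq_inner_adjoint_left]; rfl
  have h2 : star (CFC.abs A) = CFC.abs A := (CFC.abs_nonneg A).isSelfAdjoint
  have h3 : ‖CFC.abs A x‖ ^ 2 = ‖A x‖ ^ 2 := by rw [h1, h1, h2, CFC.abs_mul_abs]
  exact (sq_eq_sq₀ (norm_nonneg _) (norm_nonneg _)).1 h3

/-- A weak form of the polar decomposition. -/
lemma exists_contraction_mul_abs_eq (A : H →L[ℂ] H) :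
    ∃ D : H →L[ℂ] H, ‖D‖ ≤ 1 ∧ A = D * CFC.abs A :=
  exists_contraction_mul_eq fun x => (norm_abs_apply A x).ge

namespace NormedIdeal

variable (I : NormedIdeal H)

lemma abs_mem {A : H →L[ℂ] H} (hA : A ∈ I.carrier) : CFC.abs A ∈ I.carrier := by
  obtain ⟨C, -, hC⟩ := exists_contraction_mul_eq (A := CFC.abs A) (B := A)
    fun x => (norm_abs_apply A x).le
  rw [hC]
  exact I.mul_mem_left _ _ hA

lemma star_mem {A : H →L[ℂ] H} (hA : A ∈ I.carrier) : star A ∈ I.carrier := by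
  obtain ⟨D, -, hD⟩ := exists_contraction_mul_abs_eq A
  rw [hD, star_mul]
  have : star (CFC.abs A) = CFC.abs A := (CFC.abs_nonneg A).isSelfAdjoint
  rw [this]
  exact I.mul_mem_right _ _ (I.abs_mem hA)

lemma realPart_mem {A : H →L[ℂ] H} (hA : A ∈ I.carrier) :
    (ℜ A : H →L[ℂ] H) ∈ I.carrier := by
  rw [realPart_apply_coe, ← Complex.coe_smul]
  exact I.carrier.smul_mem _ (I.carrier.add_mem hA (I.star_mem hA))

lemma imaginaryPart_mem {A : H →L[ℂ] H} (hA : A ∈ I.carrier) :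
    (ℑ A : H →L[ℂ] H) ∈ I.carrier := by
  rw [imaginaryPart_apply_coe, ← Complex.coe_smul (2⁻¹ : ℝ)]
  exact I.carrier.smul_mem _ (I.carrier.smul_mem _ (I.carrier.sub_mem hA (I.star_mem hA)))

lemma absReIm_mem {A : H →L[ℂ] H} (hA : A ∈ I.carrier) : absReIm A ∈ I.carrier :=
  I.carrier.add_mem (I.abs_mem (I.realPart_mem hA)) (I.abs_mem (I.imaginaryPart_mem hA))

lemma inorm_mul_right_le (A : I.carrier) (T : H →L[ℂ] H) :
    I.inorm ⟨A * T, I.mul_mem_right _ T A.2⟩ ≤ I.inorm A * ‖T‖ := by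
  have h := I.inorm_mul_mul 1 T A
  simp only [one_mul] at h
  refine h.trans ?_
  gcongr
  exact mul_le_of_le_one_left (apply_nonneg _ _) ContinuousLinearMap.norm_id_le

lemma inorm_mul_left_le (A : I.carrier) (T : H →L[ℂ] H) :
    I.inorm ⟨T * A, I.mul_mem_left T _ A.2⟩ ≤ ‖T‖ * I.inorm A := by
  have h := I.inorm_mul_mul T 1 A
  simp only [mul_one] at h
  refine h.trans ?_
  exact mul_le_of_le_one_right (mul_nonneg (norm_nonneg _) (apply_nonneg _ _))
    ContinuousLinearMap.norm_id_le

end NormedIdeal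

namespace PositiveTrace

variable {I : NormedIdeal H} (τ : PositiveTrace I)

/-- A total functional frees rewriting from membership proofs; its values matter only on the ideal.
-/
lemma exists_ext : ∃ t : (H →L[ℂ] H) →ₗ[ℂ] ℂ, ∀ A (hA : A ∈ I.carrier),
    t A = τ.toFun ⟨A, hA⟩ := by
  obtain ⟨t, ht⟩ := LinearMap.exists_extend τ.toFun
  exact ⟨t, fun A hA => by rw [← ht]; rfl⟩

/-- Some linear extension of the trace to all bounded operators. -/
def ext : (H →L[ℂ] H) →ₗ[ℂ] ℂ := Classical.choose τ.exists_ext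

lemma ext_of_mem {A : H →L[ℂ] H} (hA : A ∈ I.carrier) : τ.ext A = τ.toFun ⟨A, hA⟩ :=
  Classical.choose_spec τ.exists_ext A hA

lemma ext_mul_comm {A : H →L[ℂ] H} (hA : A ∈ I.carrier) (T : H →L[ℂ] H) :
    τ.ext (T * A) = τ.ext (A * T) := by
  rw [τ.ext_of_mem (I.mul_mem_left T _ hA), τ.ext_of_mem (I.mul_mem_right _ T hA)]
  exact τ.cyclic ⟨A, hA⟩ T

lemma ext_re_nonneg {A : H →L[ℂ] H} (hA : A ∈ I.carrier) (h0 : 0 ≤ A) : 0 ≤ (τ.ext A).re := by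
  rw [τ.ext_of_mem hA]
  exact (τ.positive ⟨A, hA⟩ h0).1

lemma ext_im_eq_zero {A : H →L[ℂ] H} (hA : A ∈ I.carrier) (h0 : 0 ≤ A) : (τ.ext A).im = 0 := by
  rw [τ.ext_of_mem hA]
  exact (τ.positive ⟨A, hA⟩ h0).2

/-- A is the difference of |A| + A = 2A⁺ and |A|, both positive elements of the ideal. -/
lemma ext_im_of_isSelfAdjoint {A : H →L[ℂ] H} (hA : A ∈ I.carrier) (hs : IsSelfAdjoint A) :
    (τ.ext A).im = 0 := by
  have h1 : 0 ≤ CFC.abs A + A := by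
    rw [CFC.abs_add_self A]
    exact nsmul_nonneg (CFC.posPart_nonneg A) 2
  have h2 := τ.ext_im_eq_zero (I.carrier.add_mem (I.abs_mem hA) hA) h1
  have h3 := τ.ext_im_eq_zero (I.abs_mem hA) (CFC.abs_nonneg A)
  simpa [h3] using h2

lemma ext_star {A : H →L[ℂ] H} (hA : A ∈ I.carrier) : τ.ext (star A) = star (τ.ext A) := by
  have h1 := τ.ext_im_of_isSelfAdjoint (I.realPart_mem hA) (ℜ A).2
  have h2 := τ.ext_im_of_isSelfAdjoint (I.imaginaryPart_mem hA) (ℑ A).2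
  have hs1 : star (ℜ A : H →L[ℂ] H) = ℜ A := (ℜ A).2
  have hs2 : star (ℑ A : H →L[ℂ] H) = ℑ A := (ℑ A).2
  conv_lhs => rw [← realPart_add_I_smul_imaginaryPart A]
  conv_rhs => rw [← realPart_add_I_smul_imaginaryPart A]
  simp only [star_add, star_smul, hs1, hs2, map_add, map_smul]
  apply Complex.ext <;> simp [h1, h2]

/-- The positive semidefinite form `(R, S) ↦ τ(S P R*)`. -/
@[reducible]
def formCore {P : H →L[ℂ] H} (hP : P ∈ I.carrier) (h0 : 0 ≤ P) :
    PreInnerProductSpace.Core ℂ (H →L[ℂ] H) where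
  inner R S := τ.ext (S * P * star R)
  conj_inner_symm R S := by
    have h := τ.ext_star (I.mul_mem_right _ (star S) (I.mul_mem_left R _ hP))
    simp only [star_mul, star_star, h0.isSelfAdjoint.star_eq] at h
    rw [← mul_assoc] at h
    rw [h]
    simp
  re_inner_nonneg R :=
    τ.ext_re_nonneg (I.mul_mem_right _ _ (I.mul_mem_left _ _ hP)) (star_right_conjugate_nonneg h0 R)
  add_left R S T := by simp [mul_add]
  smul_left R S r := by simp

/-- Cauchy–Schwarz for the form (R, S) ↦ τ(S P R*) at R = 1 gives |τ(PS)|² ≤ τ(P) τ(S P S*). The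
last factor is at most ‖S‖² τ(P), because with R² = ‖S‖² - S*S one has 0 ≤ τ(R P R) = τ(P R²). -/
lemma norm_ext_mul_le_of_nonneg {P : H →L[ℂ] H} (hP : P ∈ I.carrier) (h0 : 0 ≤ P)
    (S : H →L[ℂ] H) : ‖τ.ext (P * S)‖ ≤ (τ.ext P).re * ‖S‖ := by
  have key : (τ.ext (S * P * star S)).re ≤ ‖S‖ ^ 2 * (τ.ext P).re := by
    have hle : 0 ≤ algebraMap ℝ (H →L[ℂ] H) (‖S‖ ^ 2) - star S * S :=
      sub_nonneg.2 CStarAlgebra.star_mul_le_algebraMap_norm_sq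
    set R := CFC.sqrt (algebraMap ℝ (H →L[ℂ] H) (‖S‖ ^ 2) - star S * S)
    have hR : R * R = algebraMap ℝ (H →L[ℂ] H) (‖S‖ ^ 2) - star S * S :=
      CFC.sqrt_mul_sqrt_self _ hle
    have hR0 : star R = R := (CFC.sqrt_nonneg _).isSelfAdjoint
    have h1 := τ.ext_re_nonneg (I.mul_mem_right _ (star R) (I.mul_mem_left R _ hP))
      (star_right_conjugate_nonneg h0 R)
    rw [mul_assoc, τ.ext_mul_comm (I.mul_mem_right _ _ hP), hR0, mul_assoc, hR, mul_sub, map_sub,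
      ← mul_assoc, ← τ.ext_mul_comm (I.mul_mem_right _ _ hP), Algebra.algebraMap_eq_smul_one,
      mul_smul_comm, mul_one, ← Complex.coe_smul, map_smul, ← mul_assoc] at h1
    simp only [Complex.sub_re, smul_eq_mul, Complex.re_ofReal_mul] at h1
    linarith
  let core := τ.formCore hP h0
  let _ : Inner ℂ (H →L[ℂ] H) := core.toInner
  have hcs := InnerProductSpace.Core.inner_mul_inner_self_le (𝕜 := ℂ) (1 : H →L[ℂ] H) S
  have e1 : inner ℂ (1 : H →L[ℂ] H) S = τ.ext (P * S) := by
    rw [← τ.ext_mul_comm hP]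
    change τ.ext (S * P * star 1) = _
    simp
  have e2 : ‖inner ℂ S (1 : H →L[ℂ] H)‖ = ‖τ.ext (P * S)‖ := by
    rw [← e1]
    exact InnerProductSpace.Core.norm_inner_symm _ _
  have e3 : inner ℂ (1 : H →L[ℂ] H) 1 = τ.ext P := by
    change τ.ext (1 * P * star 1) = _
    simp
  have e4 : inner ℂ S S = τ.ext (S * P * star S) := rfl
  rw [e2, e1, e3, e4] at hcs
  have hP0 := τ.ext_re_nonneg hP h0
  refine le_of_sq_le_sq ?_ (by positivity)
  calc ‖τ.ext (P * S)‖ ^ 2 ≤ (τ.ext P).re * (τ.ext (S * P * star S)).re := by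
        rw [sq]; exact hcs
    _ ≤ (τ.ext P).re * (‖S‖ ^ 2 * (τ.ext P).re) := by gcongr
    _ = ((τ.ext P).re * ‖S‖) ^ 2 := by ring

/-- With V = D|V| and D a contraction, cyclicity turns τ(VT) into τ(|V| T D), which is the positive
case. -/
lemma norm_ext_mul_le_of_isSelfAdjoint {V : H →L[ℂ] H} (hV : V ∈ I.carrier) (T : H →L[ℂ] H) :
    ‖τ.ext (V * T)‖ ≤ (τ.ext (CFC.abs V)).re * ‖T‖ := by
  obtain ⟨D, hD1, hD⟩ := exists_contraction_mul_abs_eq V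
  have h1 : τ.ext (V * T) = τ.ext (CFC.abs V * (T * D)) := by
    conv_lhs => rw [hD]
    rw [mul_assoc, τ.ext_mul_comm (I.mul_mem_right _ _ (I.abs_mem hV)), mul_assoc]
  rw [h1]
  refine (τ.norm_ext_mul_le_of_nonneg (I.abs_mem hV) (CFC.abs_nonneg V) _).trans ?_
  have := τ.ext_re_nonneg (I.abs_mem hV) (CFC.abs_nonneg V)
  gcongr
  exact (norm_mul_le _ _).trans (mul_le_of_le_one_right (norm_nonneg _) hD1)

lemma norm_ext_mul_le_absReIm {V : H →L[ℂ] H} (hV : V ∈ I.carrier) (T : H →L[ℂ] H) :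
    ‖τ.ext (V * T)‖ ≤ (τ.ext (absReIm V)).re * ‖T‖ := by
  conv_lhs => rw [← realPart_add_I_smul_imaginaryPart V]
  rw [add_mul, map_add, smul_mul_assoc, map_smul, absReIm, map_add, Complex.add_re, add_mul]
  refine (norm_add_le _ _).trans (add_le_add ?_ ?_)
  · exact τ.norm_ext_mul_le_of_isSelfAdjoint (I.realPart_mem hV) T
  · rw [norm_smul, Complex.norm_I, one_mul]
    exact τ.norm_ext_mul_le_of_isSelfAdjoint (I.imaginaryPart_mem hV) T

lemma dualNorm_nonneg : 0 ≤ τ.dualNorm := Real.sInf_nonneg fun _ h => h.1.le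

lemma norm_le_dualNorm_mul (A : I.carrier) : ‖τ.toFun A‖ ≤ τ.dualNorm * I.inorm A := by
  have hne : {M : ℝ | 0 < M ∧ ∀ A : I.carrier, ‖τ.toFun A‖ ≤ M * I.inorm A}.Nonempty := τ.bounded
  rcases (apply_nonneg I.inorm A).eq_or_lt with h0 | h0
  · obtain ⟨M, -, hM⟩ := τ.bounded
    simpa [← h0] using hM A
  · rw [← div_le_iff₀ h0]
    exact le_csInf hne fun M hM => (div_le_iff₀ h0).2 (hM.2 A)

/-- The bound of the variation estimate. -/
def varBound (V : I.carrier) : ℝ :=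
  min (τ.dualNorm * I.inorm V) (τ.ext (absReIm (V : H →L[ℂ] H))).re

lemma norm_ext_mul_le_varBound (V : I.carrier) (T : H →L[ℂ] H) :
    ‖τ.ext (V * T)‖ ≤ τ.varBound V * ‖T‖ := by
  rw [varBound, min_mul_of_nonneg _ _ (norm_nonneg _)]
  refine le_min ?_ (τ.norm_ext_mul_le_absReIm V.2 T)
  rw [τ.ext_of_mem (I.mul_mem_right _ T V.2), mul_assoc]
  refine (τ.norm_le_dualNorm_mul _).trans ?_
  gcongr
  · exact τ.dualNorm_nonneg
  · exact I.inorm_mul_right_le V T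

lemma varBound_nonneg (V : I.carrier) : 0 ≤ τ.varBound V := by
  refine le_min (mul_nonneg τ.dualNorm_nonneg (apply_nonneg _ _)) ?_
  refine τ.ext_re_nonneg (I.absReIm_mem V.2) ?_
  exact add_nonneg (CFC.abs_nonneg _) (CFC.abs_nonneg _)

lemma variationBound_of_le (V : I.carrier) {X M : Type*} [MeasurableSpace X]
    [NormedAddCommGroup M] {ν : VectorMeasure X M}
    (h : ν.variation Set.univ ≤ ENNReal.ofReal (τ.varBound V)) : VariationBound τ V ν := by
  refine ⟨I.absReIm_mem V.2, ?_⟩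
  rwa [varBound, τ.ext_of_mem (I.absReIm_mem V.2)] at h

/-- The functional `T ↦ τ(VT)` on bounded operators. -/
def mulLeft (V : I.carrier) : (H →L[ℂ] H) →L[ℂ] ℂ :=
  (τ.ext.comp (LinearMap.mulLeft ℂ (V : H →L[ℂ] H))).mkContinuous (τ.varBound V)
    (τ.norm_ext_mul_le_varBound V)

lemma mulLeft_apply (V : I.carrier) (T : H →L[ℂ] H) : τ.mulLeft V T = τ.ext (V * T) := rfl

lemma norm_mulLeft_apply_le (V : I.carrier) (T : H →L[ℂ] H) :
    ‖τ.mulLeft V T‖ ≤ τ.varBound V * ‖T‖ :=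
  τ.norm_ext_mul_le_varBound V T

/-- The conjugate of τ(VT) is τ(TV) = τ(VT). This is what makes the measures real in the
self-adjoint case. -/
lemma mulLeft_im_eq_zero {V : I.carrier} (hV : IsSelfAdjoint (V : H →L[ℂ] H)) {T : H →L[ℂ] H}
    (hT : IsSelfAdjoint T) : (τ.mulLeft V T).im = 0 := by
  rw [mulLeft_apply, ← Complex.conj_eq_iff_im, ← Complex.star_def,
    ← τ.ext_star (I.mul_mem_right _ T V.2), star_mul, hV.star_eq, hT.star_eq,
    τ.ext_mul_comm V.2]

end PositiveTrace

end OperatorIdeals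

end OpTrace
end

noncomputable section

namespace OpTrace

/-! ### Polynomials evaluated at tuples of operators. -/

section PolyEval

variable {n : ℕ}

/-- The ordered monomial `X₁^{k₁} ⋯ Xₙ^{kₙ}`. -/
def monoProd {R : Type*} [Monoid R] (X : Fin n → R) (k : Fin n → ℕ) : R :=
  (List.ofFn fun i => X i ^ k i).prod

/-- The word whose product is the ordered monomial with exponent `k`. -/
def monoWord (k : Fin n → ℕ) : List (Fin n) :=
  (List.ofFn fun i => List.replicate (k i) i).flatten

lemma prod_map_monoWord {R : Type*} [Monoid R] (X : Fin n → R) (k : Fin n → ℕ) :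
    ((monoWord k).map X).prod = monoProd X k := by
  simp only [monoWord, monoProd, List.map_flatten, List.prod_flatten, List.map_ofFn]
  congr 2
  ext i
  simp

lemma map_monoProd {R S F : Type*} [Monoid R] [Monoid S] [FunLike F R S] [MonoidHomClass F R S]
    (f : F) (X : Fin n → R) (k : Fin n → ℕ) : f (monoProd X k) = monoProd (fun i => f (X i)) k := by
  simp only [monoProd, map_list_prod, List.map_ofFn]
  congr 2
  ext i
  simp

lemma monoProd_eq_prod {R : Type*} [CommMonoid R] (X : Fin n → R) (k : Fin n → ℕ) :
    monoProd X k = ∏ i, X i ^ k i := List.prod_ofFn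

lemma length_monoWord (k : Fin n → ℕ) : (monoWord k).length = ∑ i, k i := by
  simp [monoWord, List.length_flatten, List.map_ofFn, List.sum_ofFn, Function.comp_def]

variable {R : Type*} [Ring R] [Algebra ℂ R]

/-- Evaluation of a polynomial at a tuple, with ordered monomials. -/
def polyEval (X : Fin n → R) : MvPolynomial (Fin n) ℂ →ₗ[ℂ] R :=
  (MvPolynomial.basisMonomials (Fin n) ℂ).constr ℂ fun k => monoProd X k

lemma polyEval_monomial (X : Fin n → R) (k : Fin n →₀ ℕ) (c : ℂ) :
    polyEval X (MvPolynomial.monomial k c) = c • monoProd X k := by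
  have : MvPolynomial.monomial k c = c • (MvPolynomial.basisMonomials (Fin n) ℂ) k := by
    simp [MvPolynomial.smul_monomial]
  rw [this, map_smul, polyEval, Module.Basis.constr_basis]

lemma polyEval_ext {M : Type*} [AddCommMonoid M] [Module ℂ M]
    {f g : MvPolynomial (Fin n) ℂ →ₗ[ℂ] M}
    (h : ∀ k, f (MvPolynomial.monomial k 1) = g (MvPolynomial.monomial k 1)) : f = g :=
  (MvPolynomial.basisMonomials (Fin n) ℂ).ext fun k => by simpa using h k

lemma map_polyEval {S : Type*} [Ring S] [Algebra ℂ S] (φ : R →ₐ[ℂ] S) (X : Fin n → R)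
    (p : MvPolynomial (Fin n) ℂ) : φ (polyEval X p) = polyEval (fun i => φ (X i)) p := by
  have : φ.toLinearMap.comp (polyEval X) = polyEval (fun i => φ (X i)) :=
    polyEval_ext fun k => by simp [polyEval_monomial, map_monoProd]
  exact LinearMap.congr_fun this p

lemma polyEval_eq_aeval {S : Type*} [CommRing S] [Algebra ℂ S] (x : Fin n → S)
    (p : MvPolynomial (Fin n) ℂ) : polyEval x p = MvPolynomial.aeval x p := by
  have : polyEval x = (MvPolynomial.aeval x).toLinearMap :=
    polyEval_ext fun k => by
      simp [polyEval_monomial, monoProd_eq_prod, MvPolynomial.aeval_monomial, Finsupp.prod_fintype]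
  exact LinearMap.congr_fun this p

/-- On commuting tuples, evaluation of polynomials is multiplicative. -/
lemma exists_algHom_polyEval {X : Fin n → R} (hX : ∀ i j, Commute (X i) (X j)) :
    ∃ φ : MvPolynomial (Fin n) ℂ →ₐ[ℂ] R, (∀ i, φ (MvPolynomial.X i) = X i) ∧
      ∀ p, φ p = polyEval X p := by
  -- The subalgebra generated by a commuting tuple is commutative, so `aeval` is available inside
  -- it.
  have : IsMulCommutative (Algebra.adjoin ℂ (Set.range X)) :=
    Algebra.isMulCommutative_adjoin ℂ (by rintro _ ⟨i, rfl⟩ _ ⟨j, rfl⟩; exact hX i j)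
  let _ : CommRing (Algebra.adjoin ℂ (Set.range X)) :=
    { (inferInstance : Ring (Algebra.adjoin ℂ (Set.range X))) with mul_comm := this.is_comm.comm }
  let x : Fin n → Algebra.adjoin ℂ (Set.range X) := fun i =>
    ⟨X i, Algebra.subset_adjoin ⟨i, rfl⟩⟩
  refine ⟨(Algebra.adjoin ℂ (Set.range X)).val.comp (MvPolynomial.aeval x), fun i => ?_,
    fun p => ?_⟩
  · simp [x]
  · rw [AlgHom.comp_apply, ← polyEval_eq_aeval]
    exact map_polyEval (Algebra.adjoin ℂ (Set.range X)).val x p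

end PolyEval

/-! ### Von Neumann's inequality. -/

section VonNeumann

variable {n : ℕ}

/-- The Gelfand transform is isometric, and a character sends p(t) to p evaluated at a point whose
coordinates lie in the spectra. -/
lemma norm_polyEval_le_of_forall_spectrum_of_comm {𝒜 : Type*} [CStarAlgebra 𝒜]
    (hcomm : ∀ a b : 𝒜, a * b = b * a) (t : Fin n → 𝒜) (p : MvPolynomial (Fin n) ℂ) {M : ℝ}
    (hM : 0 ≤ M)
    (h : ∀ z : Fin n → ℂ, (∀ i, z i ∈ spectrum ℂ (t i)) → ‖MvPolynomial.eval z p‖ ≤ M) :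
    ‖polyEval t p‖ ≤ M := by
  let _ : CommCStarAlgebra 𝒜 := { ‹CStarAlgebra 𝒜› with mul_comm := hcomm }
  have h1 := (AddMonoidHomClass.isometry_iff_norm (WeakDual.gelfandTransform ℂ 𝒜)).1
    (gelfandTransform_isometry 𝒜) (polyEval t p)
  rw [← h1, ContinuousMap.norm_le _ hM]
  intro χ
  have h2 : WeakDual.gelfandTransform ℂ 𝒜 (polyEval t p) χ =
      polyEval (fun i => χ (t i)) p :=
    map_polyEval (WeakDual.CharacterSpace.toAlgHom χ) t p
  rw [h2, polyEval_eq_aeval]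
  refine (congrArg norm (RingHom.congr_fun (MvPolynomial.coe_aeval_eq_eval _) p)).trans_le ?_
  exact h _ fun i => AlgHom.apply_mem_spectrum (WeakDual.CharacterSpace.toAlgHom χ) (t i)

/-- The closed star subalgebra generated by the tuple is a commutative C*-algebra, and spectra do
not change on passing to it. -/
theorem norm_polyEval_le_of_forall_spectrum {𝒜 : Type*} [CStarAlgebra 𝒜] {X : Fin n → 𝒜}
    (hX : ∀ i j, Commute (X i) (X j)) (hX' : ∀ i j, Commute (X i) (star (X j)))
    (p : MvPolynomial (Fin n) ℂ) {M : ℝ} (hM : 0 ≤ M)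
    (h : ∀ z : Fin n → ℂ, (∀ i, z i ∈ spectrum ℂ (X i)) → ‖MvPolynomial.eval z p‖ ≤ M) :
    ‖polyEval X p‖ ≤ M := by
  let S₀ := StarAlgebra.adjoin ℂ (Set.range X)
  let S := S₀.topologicalClosure
  have hS : IsClosed (S : Set 𝒜) := S₀.isClosed_topologicalClosure
  have hc0 : ∀ a b : S₀, a * b = b * a :=
    (StarAlgebra.isMulCommutative_adjoin ℂ (s := Set.range X)
      (by rintro _ ⟨i, rfl⟩ _ ⟨j, rfl⟩; exact hX i j)
      (by rintro _ ⟨i, rfl⟩ _ ⟨j, rfl⟩; exact hX' i j)).is_comm.comm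
  have hc : ∀ a b : S, a * b = b * a := (S₀.commRingTopologicalClosure hc0).mul_comm
  let t : Fin n → S := fun i =>
    ⟨X i, S₀.le_topologicalClosure (StarAlgebra.subset_adjoin ℂ _ ⟨i, rfl⟩)⟩
  let _ : CStarAlgebra S := StarSubalgebra.cstarAlgebra S (h_closed := hS)
  have h1 : polyEval X p = (polyEval t p : 𝒜) := (map_polyEval S.subtype.toAlgHom t p).symm
  have h2 : ‖polyEval t p‖ ≤ M := by
    refine norm_polyEval_le_of_forall_spectrum_of_comm hc t p hM fun z hz => h z fun i => ?_
    have := hz i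
    rw [StarSubalgebra.spectrum_eq (hS := hS)] at this
    exact this
  rw [h1]
  exact h2

lemma norm_eval_le_of_torus (p : MvPolynomial (Fin n) ℂ) {M : ℝ}
    (h : ∀ z : Fin n → ℂ, (∀ i, ‖z i‖ = 1) → ‖MvPolynomial.eval z p‖ ≤ M) (z : Fin n → ℂ)
    (hz : ∀ i, ‖z i‖ ≤ 1) : ‖MvPolynomial.eval z p‖ ≤ M := by
  -- Here s contains the coordinates not yet known to be unimodular; the maximum principle in one
  -- variable removes one of them at a time.
  suffices ∀ (s : Finset (Fin n)) (z : Fin n → ℂ), (∀ i, ‖z i‖ ≤ 1) → (∀ i ∉ s, ‖z i‖ = 1) →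
      ‖MvPolynomial.eval z p‖ ≤ M from this Finset.univ z hz (by simp)
  intro s
  induction s using Finset.induction_on with
  | empty => exact fun z _ h1 => h z (by simpa using h1)
  | insert a s ha ih =>
    intro z hz h1
    have hd : Differentiable ℂ fun w : ℂ => MvPolynomial.eval (Function.update z a w) p := by
      simp_rw [MvPolynomial.eval_eq']
      refine Differentiable.fun_sum fun k _ => Differentiable.const_mul ?_ _
      refine Differentiable.fun_finsetProd fun i _ => Differentiable.pow ?_ _
      by_cases hi : i = a
      · subst hi; simp
      · simp [hi]
    have := Complex.norm_le_of_forall_mem_frontier_norm_le (U := Metric.ball (0 : ℂ) 1)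
      Metric.isBounded_ball hd.diffContOnCl (C := M) (fun w hw => ?_) (z := z a) ?_
    · simpa using this
    · rw [frontier_ball (0 : ℂ) one_ne_zero, mem_sphere_zero_iff_norm] at hw
      refine ih _ (fun i => ?_) fun i hi => ?_
      · by_cases hia : i = a
        · subst hia; simp [hw]
        · simp [hia, hz i]
      · by_cases hia : i = a
        · subst hia; simp [hw]
        · simpa [hia] using h1 i (by simp [hia, hi])
    · rw [closure_ball (0 : ℂ) one_ne_zero, mem_closedBall_zero_iff]
      exact hz a

variable {H : Type*} [NormedAddCommGroup H] [InnerProductSpace ℂ H] [CompleteSpace H]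

/-- The von Neumann inequality for tuples with a commuting normal contractive dilation. -/
theorem HasCommutingNormalDilation.norm_polyEval_le {X : Fin n → H →L[ℂ] H}
    (hX : HasCommutingNormalDilation X) (p : MvPolynomial (Fin n) ℂ) {M : ℝ} (hM : 0 ≤ M)
    (h : ∀ z : Fin n → ℂ, (∀ i, ‖z i‖ = 1) → ‖MvPolynomial.eval z p‖ ≤ M) :
    ‖polyEval X p‖ ≤ M := by
  obtain ⟨K, _, _, _, ι, U, ⟨hU1, hUc⟩, hUn, hw⟩ := hX
  let J : H →L[ℂ] K := ι.toContinuousLinearMap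
  have hJ1 : ‖J‖ ≤ 1 := ι.norm_toContinuousLinearMap_le
  have hJ : (ContinuousLinearMap.adjoint J).comp J = ContinuousLinearMap.id ℂ H :=
    ContinuousLinearMap.norm_map_iff_adjoint_comp_self J |>.1 fun x => ι.norm_map x
  have hmono : ∀ k : Fin n → ℕ, monoProd X k =
      (ContinuousLinearMap.adjoint J).comp ((monoProd U k).comp J) := by
    intro k
    -- The dilation is assumed only for nonempty words; the empty word is the isometry relation J*J
    -- = 1.
    by_cases hk : monoWord k = []
    · rw [← prod_map_monoWord, ← prod_map_monoWord, hk]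
      simp only [List.map_nil, List.prod_nil]
      exact hJ.symm
    · rw [← prod_map_monoWord, ← prod_map_monoWord]
      exact hw _ hk
  have hp : ∀ p, polyEval X p =
      (ContinuousLinearMap.adjoint J).comp ((polyEval U p).comp J) := by
    intro p
    induction p using MvPolynomial.induction_on' with
    | monomial k c => simp [polyEval_monomial, hmono]
    | add p q hp hq =>
      rw [map_add, map_add, hp, hq]
      ext x
      simp
  have hUp : ‖polyEval U p‖ ≤ M := by
    -- Commutation of U_i with the adjoint of the normal operator U_j is Fuglede's theorem.
    refine norm_polyEval_le_of_forall_spectrum hUc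
      (fun i j => (hUn j).commute_star_right (hUc i j)) p hM fun z hz => ?_
    refine norm_eval_le_of_torus p h z fun i => ?_
    exact (spectrum.norm_le_norm_mul_of_mem (hz i)).trans
      (mul_le_one₀ (hU1 i) (norm_nonneg _) ContinuousLinearMap.norm_id_le)
  rw [hp]
  calc _ ≤ ‖ContinuousLinearMap.adjoint J‖ * (‖polyEval U p‖ * ‖J‖) :=
        (ContinuousLinearMap.opNorm_comp_le _ _).trans
          (by gcongr; exact ContinuousLinearMap.opNorm_comp_le _ _)
    _ ≤ 1 * (M * 1) := by
        rw [LinearIsometryEquiv.norm_map]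
        gcongr
    _ = M := by ring

end VonNeumann

/-! ### Self-adjoint paths: polynomial bounds on the spectral hulls. -/

section SelfAdjoint

variable {H : Type*} [NormedAddCommGroup H] [InnerProductSpace ℂ H] [CompleteSpace H]

/-- The convex hull of the union of the spectra. -/
def specHull (A B : H →L[ℂ] H) : Set ℝ := convexHull ℝ (spectrum ℝ A ∪ spectrum ℝ B)

lemma isCompact_convexHull_real {K : Set ℝ} (hK : IsCompact K) : IsCompact (convexHull ℝ K) := by
  rcases K.eq_empty_or_nonempty with rfl | hne
  · simp
  obtain ⟨a, haK, ha⟩ := hK.exists_isLeast hne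
  obtain ⟨b, hbK, hb⟩ := hK.exists_isGreatest hne
  have : convexHull ℝ K = Set.Icc a b := by
    refine (convexHull_min (t := Set.Icc a b) (fun x hx => ⟨ha hx, hb hx⟩) (convex_Icc _ _)).antisymm ?_
    rw [← segment_eq_Icc (ha hbK)]
    exact segment_subset_convexHull haK hbK
  rw [this]
  exact isCompact_Icc

lemma isCompact_specHull (A B : H →L[ℂ] H) : IsCompact (specHull A B) :=
  isCompact_convexHull_real ((ContinuousFunctionalCalculus.isCompact_spectrum A).union
    (ContinuousFunctionalCalculus.isCompact_spectrum B))

lemma spectrum_real_subset_Icc {A : H →L[ℂ] H} (hA : ‖A‖ ≤ 1) :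
    spectrum ℝ A ⊆ Set.Icc (-1 : ℝ) 1 := fun _ hx =>
  abs_le.1 ((spectrum.norm_le_norm_mul_of_mem hx).trans
    (mul_le_one₀ hA (norm_nonneg _) ContinuousLinearMap.norm_id_le))

lemma specHull_subset_Icc {A B : H →L[ℂ] H} (hA : ‖A‖ ≤ 1) (hB : ‖B‖ ≤ 1) :
    specHull A B ⊆ Set.Icc (-1 : ℝ) 1 :=
  convexHull_min (Set.union_subset (spectrum_real_subset_Icc hA) (spectrum_real_subset_Icc hB))
    (convex_Icc _ _)

lemma isSelfAdjoint_linePath {n : ℕ} {A B : Fin n → H →L[ℂ] H} (hA : ∀ j, IsSelfAdjoint (A j))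
    (hB : ∀ j, IsSelfAdjoint (B j)) (t : ℝ) (j : Fin n) : IsSelfAdjoint (linePath A B t j) :=
  (hA j).add (IsSelfAdjoint.smul (Complex.conj_ofReal t) ((hB j).sub (hA j)))

/-- If a and b are the extreme points of the two spectra, A_j and B_j both lie between a·1 and b·1
in the operator order, and so does every convex combination. -/
lemma spectrum_linePath_subset_specHull {n : ℕ} {A B : Fin n → H →L[ℂ] H}
    (hA : ∀ j, IsSelfAdjoint (A j)) (hB : ∀ j, IsSelfAdjoint (B j)) {t : ℝ}
    (ht : t ∈ Set.Icc (0 : ℝ) 1) (j : Fin n) :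
    spectrum ℝ (linePath A B t j) ⊆ specHull (A j) (B j) := by
  rcases subsingleton_or_nontrivial H with hH | hH
  · intro x hx
    have : Subsingleton (H →L[ℂ] H) := inferInstance
    simp [spectrum.of_subsingleton] at hx
  have hX := isSelfAdjoint_linePath hA hB t j
  set K := spectrum ℝ (A j) ∪ spectrum ℝ (B j)
  have hK : IsCompact K := (ContinuousFunctionalCalculus.isCompact_spectrum (A j)).union
    (ContinuousFunctionalCalculus.isCompact_spectrum (B j))
  have hne : K.Nonempty := (ContinuousFunctionalCalculus.spectrum_nonempty (A j) (hA j)).inl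
  obtain ⟨a, haK, ha⟩ := hK.exists_isLeast hne
  obtain ⟨b, hbK, hb⟩ := hK.exists_isGreatest hne
  have hconv : linePath A B t j = (1 - t) • A j + t • B j := by
    simp only [linePath]
    rw [← Complex.coe_smul (1 - t), ← Complex.coe_smul t]
    push_cast
    module
  have hcomb : ∀ r : ℝ, (1 - t) • algebraMap ℝ (H →L[ℂ] H) r + t • algebraMap ℝ (H →L[ℂ] H) r
      = algebraMap ℝ _ r := fun r => by module
  have h1 : algebraMap ℝ (H →L[ℂ] H) a ≤ linePath A B t j := by
    rw [hconv, ← hcomb]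
    refine add_le_add (smul_le_smul_of_nonneg_left ?_ (by linarith [ht.2]))
      (smul_le_smul_of_nonneg_left ?_ ht.1)
    · exact (algebraMap_le_iff_le_spectrum (ha := hA j)).2 fun x hx => ha (Or.inl hx)
    · exact (algebraMap_le_iff_le_spectrum (ha := hB j)).2 fun x hx => ha (Or.inr hx)
  have h2 : linePath A B t j ≤ algebraMap ℝ (H →L[ℂ] H) b := by
    rw [hconv, ← hcomb]
    refine add_le_add (smul_le_smul_of_nonneg_left ?_ (by linarith [ht.2]))
      (smul_le_smul_of_nonneg_left ?_ ht.1)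
    · exact (le_algebraMap_iff_spectrum_le (ha := hA j)).2 fun x hx => hb (Or.inl hx)
    · exact (le_algebraMap_iff_spectrum_le (ha := hB j)).2 fun x hx => hb (Or.inr hx)
  intro x hx
  have hxa := (algebraMap_le_iff_le_spectrum (ha := hX)).1 h1 x hx
  have hxb := (le_algebraMap_iff_spectrum_le (ha := hX)).1 h2 x hx
  refine segment_subset_convexHull haK hbK ?_
  rw [segment_eq_Icc (hxa.trans hxb)]
  exact ⟨hxa, hxb⟩

theorem norm_polyEval_linePath_le_of_isSelfAdjoint {n : ℕ} {A B : Fin n → H →L[ℂ] H}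
    (hA : ∀ j, IsSelfAdjoint (A j)) (hB : ∀ j, IsSelfAdjoint (B j)) {t : ℝ}
    (ht : t ∈ Set.Icc (0 : ℝ) 1) (hc : ∀ i j, Commute (linePath A B t i) (linePath A B t j))
    (p : MvPolynomial (Fin n) ℂ) {M : ℝ} (hM : 0 ≤ M)
    (h : ∀ x : Fin n → ℝ, (∀ i, x i ∈ specHull (A i) (B i)) →
      ‖MvPolynomial.eval (fun i => (x i : ℂ)) p‖ ≤ M) :
    ‖polyEval (linePath A B t) p‖ ≤ M := by
  have hX := isSelfAdjoint_linePath hA hB t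
  refine norm_polyEval_le_of_forall_spectrum hc
    (fun i j => by rw [(hX j).star_eq]; exact hc i j) p hM fun z hz => ?_
  have hre : ∀ i, z i = ((z i).re : ℂ) := fun i => (hX i).mem_spectrum_eq_re (hz i)
  have := h (fun i => (z i).re) fun i => by
    refine spectrum_linePath_subset_specHull hA hB ht i ?_
    have h1 := hz i
    rw [hre i] at h1
    exact (spectrum.algebraMap_mem_iff ℂ).1 h1
  simp_rw [← hre] at this
  exact this

end SelfAdjoint

end OpTrace
end

noncomputable section

namespace OpTrace

/-! ### Power series over ℝ or ℂ and their partial derivatives. -/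

section PowerSeries

variable {𝕜 : Type*} [RCLike 𝕜] [NormedAlgebra 𝕜 ℂ]

/-- A slightly larger radius absorbs the factor m: m s^(m-1) is at most ∑ r^i s^(m-1-i) = (r^m -
s^m)/(r - s). -/
lemma mul_pow_pred_le_pow_div {s r : ℝ} (hs : 0 ≤ s) (hsr : s < r) (m : ℕ) :
    m * s ^ (m - 1) ≤ r ^ m / (r - s) := by
  rw [le_div_iff₀ (sub_pos.2 hsr)]
  have h1 : (m : ℝ) * s ^ (m - 1) ≤ ∑ i ∈ Finset.range m, r ^ i * s ^ (m - 1 - i) := by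
    have : (m : ℝ) * s ^ (m - 1) = ∑ i ∈ Finset.range m, s ^ i * s ^ (m - 1 - i) := by
      rw [Finset.sum_congr rfl (g := fun _ => s ^ (m - 1))]
      · simp
      · intro i hi
        rw [← pow_add]
        congr 1
        have := Finset.mem_range.1 hi
        omega
    rw [this]
    gcongr
  calc _ ≤ (∑ i ∈ Finset.range m, r ^ i * s ^ (m - 1 - i)) * (r - s) := by
        gcongr
    _ = r ^ m - s ^ m := (Commute.all r s).geom_sum₂_mul m
    _ ≤ r ^ m := sub_le_self _ (pow_nonneg hs m)

variable {ι : Type*} {a : ι → ℂ} {m : ι → ℕ} {R : ℝ} {f : 𝕜 → ℂ}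

lemma summable_norm_mul_pow_of_hasSum
    (h : ∀ w : 𝕜, ‖w‖ < R → HasSum (fun i => a i * algebraMap 𝕜 ℂ (w ^ m i)) (f w)) {r : ℝ}
    (hr0 : 0 ≤ r) (hr : r < R) : Summable fun i => ‖a i‖ * r ^ m i := by
  have hn : ‖(r : 𝕜)‖ = r := by rw [RCLike.norm_ofReal, abs_of_nonneg hr0]
  refine (h (r : 𝕜) (by rwa [hn])).summable.norm.congr fun i => ?_
  rw [norm_mul, norm_algebraMap', norm_pow, hn]

lemma summable_norm_mul_deriv_of_hasSum
    (h : ∀ w : 𝕜, ‖w‖ < R → HasSum (fun i => a i * algebraMap 𝕜 ℂ (w ^ m i)) (f w)) {s : ℝ}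
    (hs0 : 0 ≤ s) (hs : s < R) : Summable fun i => ‖a i‖ * (m i * s ^ (m i - 1)) := by
  obtain ⟨r, hsr, hr⟩ := exists_between hs
  refine ((summable_norm_mul_pow_of_hasSum h (hs0.trans hsr.le) hr).div_const
    (r - s)).of_nonneg_of_le (fun i => by positivity) fun i => ?_
  rw [mul_div_assoc]
  gcongr
  exact mul_pow_pred_le_pow_div hs0 hsr _

/-- Termwise differentiation of a power series. -/
lemma hasDerivAt_of_hasSum
    (h : ∀ w : 𝕜, ‖w‖ < R → HasSum (fun i => a i * algebraMap 𝕜 ℂ (w ^ m i)) (f w)) {w : 𝕜}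
    (hw : ‖w‖ < R) :
    HasDerivAt f (∑' i, a i * (m i * algebraMap 𝕜 ℂ (w ^ (m i - 1)))) w := by
  obtain ⟨s, hws, hs⟩ := exists_between hw
  have hs0 : 0 ≤ s := (norm_nonneg w).trans hws.le
  have hmem : ∀ y : 𝕜, y ∈ Metric.ball (0 : 𝕜) s ↔ ‖y‖ < s := fun y => mem_ball_zero_iff
  have hd := hasDerivAt_tsum_of_isPreconnected (𝕜 := 𝕜) (F := ℂ)
    (g := fun i y => a i * algebraMap 𝕜 ℂ (y ^ m i))
    (g' := fun i y => a i * (m i * algebraMap 𝕜 ℂ (y ^ (m i - 1))))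
    (summable_norm_mul_deriv_of_hasSum h hs0 hs) (t := Metric.ball (0 : 𝕜) s) Metric.isOpen_ball
    (convex_ball (0 : 𝕜) s).isPreconnected (fun i y _ => ?_) (fun i y hy => ?_)
    ((hmem w).2 hws) (h w hw).summable ((hmem w).2 hws)
  · refine hd.congr_of_eventuallyEq ?_
    filter_upwards [Metric.isOpen_ball.mem_nhds ((hmem w).2 hws)] with y hy
    exact ((h y (((hmem y).1 hy).trans hs)).tsum_eq).symm
  · refine HasDerivAt.const_mul _ ?_
    have h1 := ((algebraMapCLM 𝕜 ℂ).hasFDerivAt (x := y ^ m i)).comp_hasDerivAt y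
      (hasDerivAt_pow (m i) y)
    exact h1.congr_deriv (by simp)
  · rw [norm_mul, norm_mul, norm_algebraMap', norm_pow, Complex.norm_natCast]
    have := ((hmem y).1 hy).le
    gcongr

variable {n : ℕ} {ε : ℝ}

lemma prod_update_pow {R : Type*} [CommMonoid R] (z : Fin n → R) (j : Fin n) (w : R)
    (k : Fin n → ℕ) :
    ∏ i, Function.update z j w i ^ k i = (∏ i ∈ Finset.univ.erase j, z i ^ k i) * w ^ k j := by
  rw [← Finset.prod_erase_mul _ _ (Finset.mem_univ j), Function.update_self]
  congr 1
  refine Finset.prod_congr rfl fun i hi => ?_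
  rw [Function.update_of_ne (Finset.ne_of_mem_erase hi)]

/-- The exponent `k - e_j`. -/
def lowerExp (j : Fin n) (k : Fin n → ℕ) : Fin n → ℕ := Function.update k j (k j - 1)

lemma prod_pow_lowerExp {R : Type*} [CommMonoid R] (z : Fin n → R) (j : Fin n) (k : Fin n → ℕ) :
    ∏ i, z i ^ lowerExp j k i = (∏ i ∈ Finset.univ.erase j, z i ^ k i) * z j ^ (k j - 1) := by
  rw [← Finset.prod_erase_mul _ _ (Finset.mem_univ j), lowerExp, Function.update_self]
  congr 1
  refine Finset.prod_congr rfl fun i hi => ?_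
  rw [Function.update_of_ne (Finset.ne_of_mem_erase hi)]

namespace HasTaylor

variable {f : (Fin n → 𝕜) → ℂ} {c : (Fin n → ℕ) → ℂ}

lemma hasSum_update (hf : HasTaylor ε f c) (j : Fin n) {z : Fin n → 𝕜}
    (hz : ∀ i, ‖z i‖ < 1 + ε) (w : 𝕜) (hw : ‖w‖ < 1 + ε) :
    HasSum (fun k => c k * algebraMap 𝕜 ℂ (∏ i ∈ Finset.univ.erase j, z i ^ k i) *
      algebraMap 𝕜 ℂ (w ^ k j)) (f (Function.update z j w)) := by
  refine (hf (Function.update z j w) fun i => ?_).congr_fun fun k => ?_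
  · by_cases hi : i = j
    · subst hi; simpa
    · simpa [hi] using hz i
  · rw [prod_update_pow, map_mul, mul_assoc]

lemma partialD_eq_tsum (hf : HasTaylor ε f c) (j : Fin n) {z : Fin n → 𝕜}
    (hz : ∀ i, ‖z i‖ < 1 + ε) :
    partialD j f z = ∑' k, c k * k j * algebraMap 𝕜 ℂ (∏ i, z i ^ lowerExp j k i) := by
  rw [partialD, (hasDerivAt_of_hasSum (hf.hasSum_update j hz) (hz j)).deriv]
  refine tsum_congr fun k => ?_
  rw [prod_pow_lowerExp, map_mul]
  ring

lemma summable_norm_mul (hε : 0 < ε) (hf : HasTaylor ε f c) (j : Fin n) :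
    Summable fun k => ‖c k‖ * k j := by
  -- The point with all coordinates 1 lies inside the polydisc because ε > 0, and there every
  -- monomial has modulus 1.
  have h := summable_norm_mul_deriv_of_hasSum (hf.hasSum_update j (z := fun _ => 1)
    (fun _ => by simpa using hε)) zero_le_one (by linarith)
  simpa using h

lemma summable_norm (hε : 0 < ε) (hf : HasTaylor ε f c) : Summable fun k => ‖c k‖ := by
  have := (hf (fun _ => 1) (fun _ => by simpa using hε)).summable.norm
  simpa using this

end HasTaylor

namespace HasTaylorOne

variable {g : 𝕜 → ℂ} {c : ℕ → ℂ}

/-- A function of one coordinate, as a function of several variables. -/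
lemma comp_apply (hg : HasTaylorOne ε g c) (j : Fin n) :
    HasTaylor ε (fun z : Fin n → 𝕜 => g (z j))
      (Function.extend (fun m => Pi.single j m) c 0) := by
  intro z hz
  have hinj : Function.Injective fun m : ℕ => (Pi.single j m : Fin n → ℕ) :=
    Pi.single_injective (M := fun _ => ℕ) j
  rw [← hinj.hasSum_iff]
  · refine (hg (z j) (hz j)).congr_fun fun m => ?_
    simp only [Function.comp_apply, hinj.extend_apply]
    congr 2
    rw [Finset.prod_eq_single j] <;> simp +contextual
  · intro k hk
    rw [Function.extend_apply' _ _ _ (by simpa using hk)]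
    simp

lemma exists_antideriv (hg : HasTaylorOne ε g c) :
    ∃ (G : 𝕜 → ℂ) (c' : ℕ → ℂ), HasTaylorOne ε G c' ∧ ∀ z, ‖z‖ < 1 + ε → deriv G z = g z := by
  -- At m = 0 the division by zero returns 0, so the antiderivative has no constant term.
  let c' : ℕ → ℂ := fun m => c (m - 1) / m
  have hs : ∀ z : 𝕜, ‖z‖ < 1 + ε → Summable fun m => c' m * algebraMap 𝕜 ℂ (z ^ m) := by
    intro z hz
    rw [← summable_nat_add_iff 1]
    refine ((hg z hz).summable.norm.mul_right ‖z‖).of_norm_bounded fun m => ?_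
    simp only [c', Nat.add_sub_cancel, norm_mul, norm_div, norm_algebraMap', norm_pow, pow_succ,
      Complex.norm_natCast]
    rw [← mul_assoc]
    gcongr
    exact div_le_self (norm_nonneg _) (by simp)
  have hG : HasTaylorOne ε (fun z => ∑' m, c' m * algebraMap 𝕜 ℂ (z ^ m)) c' :=
    fun z hz => (hs z hz).hasSum
  refine ⟨_, c', hG, fun z hz => ?_⟩
  rw [(hasDerivAt_of_hasSum hG hz).deriv, ← (hg z hz).tsum_eq]
  have hsum := summable_norm_mul_deriv_of_hasSum hG (norm_nonneg z) hz
  rw [Summable.tsum_eq_zero_add]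
  · simp only [CharP.cast_eq_zero, zero_mul, mul_zero, zero_add, Nat.add_sub_cancel, c']
    refine tsum_congr fun m => ?_
    have : ((m + 1 : ℕ) : ℂ) ≠ 0 := by exact_mod_cast m.succ_ne_zero
    field_simp
  · refine hsum.of_norm_bounded fun m => le_of_eq ?_
    rw [norm_mul, norm_mul, norm_algebraMap', norm_pow, Complex.norm_natCast]

end HasTaylorOne

lemma partialD_comp_apply_self (g : 𝕜 → ℂ)
    (j : Fin n) (z : Fin n → 𝕜) : partialD j (fun z => g (z j)) z = deriv g (z j) := by
  simp [partialD]

lemma partialD_comp_apply_of_ne (g : 𝕜 → ℂ) {i j : Fin n}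
    (h : j ≠ i) (z : Fin n → 𝕜) : partialD i (fun z => g (z j)) z = 0 := by
  simp [partialD, h]

end PowerSeries

section ContinuousSeries

variable {𝕜 : Type*} [RCLike 𝕜] [NormedAlgebra 𝕜 ℂ] {n : ℕ} {Y : Type*} [TopologicalSpace Y]
  [CompactSpace Y] (e : C(Y, Fin n → 𝕜))

/-- The monomial with exponent `k` in the coordinates `e`, as a continuous function. -/
def monoC (k : Fin n → ℕ) : C(Y, ℂ) :=
  ⟨fun y => algebraMap 𝕜 ℂ (∏ i, e y i ^ k i), by
    refine (algebraMapCLM 𝕜 ℂ).continuous.comp ?_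
    fun_prop⟩

lemma norm_monoC_le (he : ∀ y i, ‖e y i‖ ≤ 1) (k : Fin n → ℕ) : ‖monoC e k‖ ≤ 1 := by
  refine (ContinuousMap.norm_le _ zero_le_one).2 fun y => ?_
  change ‖algebraMap 𝕜 ℂ (∏ i, e y i ^ k i)‖ ≤ 1
  rw [norm_algebraMap', norm_prod]
  simp only [norm_pow]
  exact Finset.prod_le_one (fun _ _ => by positivity) fun i _ => pow_le_one₀ (norm_nonneg _) (he y i)

/-- The partial derivative of a power series is a continuous function, given by the uniformly
convergent differentiated series. -/
lemma HasTaylor.exists_hasSum_monoC {ε : ℝ} (hε : 0 < ε) {f : (Fin n → 𝕜) → ℂ}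
    {c : (Fin n → ℕ) → ℂ} (hf : HasTaylor ε f c) (he : ∀ y i, ‖e y i‖ ≤ 1) (j : Fin n) :
    ∃ G : C(Y, ℂ), (∀ y, G y = partialD j f (e y)) ∧
      HasSum (fun k => (c k * k j) • monoC e (lowerExp j k)) G := by
  have hs : Summable fun k => (c k * k j) • monoC e (lowerExp j k) := by
    refine (hf.summable_norm_mul hε j).of_norm_bounded fun k => ?_
    rw [norm_smul, norm_mul, Complex.norm_natCast]
    exact mul_le_of_le_one_right (by positivity) (norm_monoC_le e he _)
  refine ⟨_, fun y => ?_, hs.hasSum⟩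
  rw [hf.partialD_eq_tsum j fun i => (he y i).trans_lt (by linarith)]
  rw [← ContinuousMap.tsum_apply hs]
  rfl

end ContinuousSeries

end OpTrace
end

noncomputable section

namespace OpTrace

/-! ### Convergence of f(B) - f(A) in the ideal norm. -/

section IdealSpace

variable {H : Type*} [NormedAddCommGroup H] [InnerProductSpace ℂ H] [CompleteSpace H]

/-- A normed ideal as a space with its ideal norm. -/
def NormedIdeal.Space (I : NormedIdeal H) : Type _ := I.carrier

variable (I : NormedIdeal H)

instance : AddCommGroup I.Space := inferInstanceAs (AddCommGroup I.carrier)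

instance : Module ℂ I.Space := inferInstanceAs (Module ℂ I.carrier)

instance : SeminormedAddCommGroup I.Space :=
  AddGroupSeminorm.toSeminormedAddCommGroup (E := I.Space) I.inorm.toAddGroupSeminorm

instance : NormedSpace ℂ I.Space where
  norm_smul_le c A := (map_smul_eq_mul I.inorm c A).le

instance : CompleteSpace I.Space := by
  refine Metric.complete_of_cauchySeq_tendsto fun u hu => ?_
  have hu' := Metric.cauchySeq_iff.1 hu
  obtain ⟨a, ha⟩ : ∃ a : I.Space, ∀ δ : ℝ, 0 < δ → ∃ N : ℕ, ∀ m : ℕ, N ≤ m → ‖u m - a‖ < δ :=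
    I.complete u fun δ hδ => by
    obtain ⟨N, hN⟩ := hu' δ hδ
    exact ⟨N, fun m k hm hk => by
      have := hN m hm k hk
      rwa [dist_eq_norm] at this⟩
  refine ⟨a, Metric.tendsto_atTop.2 fun δ hδ => ?_⟩
  obtain ⟨N, hN⟩ := ha δ hδ
  exact ⟨N, fun m hm => (dist_eq_norm (u m) a).trans_lt (hN m hm)⟩

/-- Continuity of the inclusion identifies a sum taken in the ideal norm with the same sum in the
operator norm. -/
lemma NormedIdeal.exists_valCLM : ∃ v : I.Space →L[ℂ] (H →L[ℂ] H), ∀ A : I.carrier, v A = A := by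
  obtain ⟨K, -, hK⟩ := I.norm_bound
  let v : I.Space →ₗ[ℂ] (H →L[ℂ] H) := I.carrier.subtype
  exact ⟨v.mkContinuous K hK, fun A => rfl⟩

lemma PositiveTrace.exists_traceCLM {I : NormedIdeal H} (τ : PositiveTrace I) :
    ∃ t : I.Space →L[ℂ] ℂ, ∀ A : I.carrier, t A = τ.ext A := by
  obtain ⟨M, -, hM⟩ := τ.bounded
  let t : I.Space →ₗ[ℂ] ℂ := τ.toFun
  exact ⟨t.mkContinuous M hM, fun A => (τ.ext_of_mem A.2).symm⟩

end IdealSpace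

section Words

variable {H : Type*} [NormedAddCommGroup H] [InnerProductSpace ℂ H] [CompleteSpace H]
  (I : NormedIdeal H) {n : ℕ}

omit [CompleteSpace H] in
lemma prod_cons_sub (X Y : Fin n → H →L[ℂ] H) (i : Fin n) (w : List (Fin n)) :
    ((i :: w).map X).prod - ((i :: w).map Y).prod =
      (X i - Y i) * (w.map X).prod + Y i * ((w.map X).prod - (w.map Y).prod) := by
  simp only [List.map_cons, List.prod_cons]
  noncomm_ring

lemma NormedIdeal.word_sub_mem {X Y : Fin n → H →L[ℂ] H} (h : ∀ i, X i - Y i ∈ I.carrier)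
    (w : List (Fin n)) : (w.map X).prod - (w.map Y).prod ∈ I.carrier := by
  induction w with
  | nil => simp
  | cons i w ih =>
    rw [prod_cons_sub]
    exact I.carrier.add_mem (I.mul_mem_right _ _ (h i)) (I.mul_mem_left _ _ ih)

lemma norm_prod_word_le {X : Fin n → H →L[ℂ] H} (hX : ∀ i, ‖X i‖ ≤ 1) (w : List (Fin n)) :
    ‖(w.map X).prod‖ ≤ 1 := by
  induction w with
  | nil => exact ContinuousLinearMap.norm_id_le
  | cons i w ih =>
    rw [List.map_cons, List.prod_cons]
    exact (norm_mul_le _ _).trans (mul_le_one₀ (hX i) (norm_nonneg _) ih)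

lemma norm_monoProd_le {X : Fin n → H →L[ℂ] H} (hX : ∀ i, ‖X i‖ ≤ 1) (k : Fin n → ℕ) :
    ‖monoProd X k‖ ≤ 1 := by
  rw [← prod_map_monoWord]
  exact norm_prod_word_le hX _

/-- Replacing the letters one by one costs at most C each, as all remaining factors are
contractions. The linear growth in the length is matched by the summability of |c_k| k_j. -/
lemma NormedIdeal.inorm_word_sub_le {X Y : Fin n → H →L[ℂ] H} (h : ∀ i, X i - Y i ∈ I.carrier)
    (hX : ∀ i, ‖X i‖ ≤ 1) (hY : ∀ i, ‖Y i‖ ≤ 1) {C : ℝ}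
    (hC : ∀ i, I.inorm ⟨X i - Y i, h i⟩ ≤ C) (w : List (Fin n)) :
    I.inorm ⟨(w.map X).prod - (w.map Y).prod, I.word_sub_mem h w⟩ ≤ w.length * C := by
  induction w with
  | nil =>
    have e : (⟨(([] : List (Fin n)).map X).prod - (([] : List (Fin n)).map Y).prod,
        I.word_sub_mem h []⟩ : I.carrier) = 0 := Subtype.ext (by simp)
    rw [e, map_zero]
    simp
  | cons i w ih =>
    have e : (⟨((i :: w).map X).prod - ((i :: w).map Y).prod, I.word_sub_mem h (i :: w)⟩ :
        I.carrier) = ⟨(X i - Y i) * (w.map X).prod, I.mul_mem_right _ _ (h i)⟩ +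
          ⟨Y i * ((w.map X).prod - (w.map Y).prod), I.mul_mem_left _ _ (I.word_sub_mem h w)⟩ :=
      Subtype.ext (prod_cons_sub X Y i w)
    rw [e]
    have h1 := I.inorm_mul_right_le ⟨X i - Y i, h i⟩ (w.map X).prod
    have h2 := I.inorm_mul_left_le ⟨_, I.word_sub_mem h w⟩ (Y i)
    have h3 := norm_prod_word_le hX w
    have h4 := apply_nonneg I.inorm ⟨X i - Y i, h i⟩
    have h5 := apply_nonneg I.inorm ⟨_, I.word_sub_mem h w⟩
    refine (map_add_le_add I.inorm _ _).trans ?_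
    have h6 := mul_le_of_le_one_right h4 h3
    have h7 := mul_le_of_le_one_left h5 (hY i)
    have h8 := hC i
    push_cast [List.length_cons]
    linarith

end Words

section OpFun

variable {H : Type*} [NormedAddCommGroup H] [InnerProductSpace ℂ H] [CompleteSpace H]
  {I : NormedIdeal H} (τ : PositiveTrace I) {n : ℕ}

lemma hasSum_opFun {X : Fin n → H →L[ℂ] H} (hX : ∀ i, ‖X i‖ ≤ 1) {c : (Fin n → ℕ) → ℂ}
    (hc : Summable fun k => ‖c k‖) : HasSum (fun k => c k • monoProd X k) (opFun c X) := by
  refine Summable.hasSum (hc.of_norm_bounded fun k => ?_)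
  rw [norm_smul]
  exact mul_le_of_le_one_right (norm_nonneg _) (norm_monoProd_le hX k)

/-- `f(B) - f(A)` is the sum of its power series in the norm of the ideal. -/
theorem opFun_sub_mem_and_hasSum {A B : Fin n → H →L[ℂ] H} (hA : ∀ i, ‖A i‖ ≤ 1)
    (hB : ∀ i, ‖B i‖ ≤ 1) (hV : ∀ i, B i - A i ∈ I.carrier) {c : (Fin n → ℕ) → ℂ}
    (hc : Summable fun k => ‖c k‖) (hck : ∀ j, Summable fun k => ‖c k‖ * k j) :
    opFun c B - opFun c A ∈ I.carrier ∧
      HasSum (fun k => c k * τ.ext (monoProd B k - monoProd A k))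
        (τ.ext (opFun c B - opFun c A)) := by
  obtain ⟨v, hv⟩ := I.exists_valCLM
  obtain ⟨t, ht⟩ := τ.exists_traceCLM
  have hmem : ∀ k, monoProd B k - monoProd A k ∈ I.carrier := fun k => by
    rw [← prod_map_monoWord, ← prod_map_monoWord]
    exact I.word_sub_mem hV _
  let d : (Fin n → ℕ) → I.Space := fun k => (⟨monoProd B k - monoProd A k, hmem k⟩ : I.carrier)
  obtain ⟨C, hC⟩ : ∃ C : ℝ, ∀ i, I.inorm ⟨B i - A i, hV i⟩ ≤ C :=
    ⟨∑ i, I.inorm ⟨B i - A i, hV i⟩, fun i =>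
      Finset.single_le_sum (f := fun i => I.inorm ⟨B i - A i, hV i⟩)
        (fun i _ => apply_nonneg _ _) (Finset.mem_univ i)⟩
  have hd : ∀ k, ‖d k‖ ≤ (∑ j, (k j : ℝ)) * C := fun k => by
    have h := I.inorm_word_sub_le hV hB hA hC (monoWord k)
    rw [length_monoWord] at h
    simp only [prod_map_monoWord] at h
    push_cast at h
    exact h
  have hs : Summable fun k => c k • d k := by
    have h1 : Summable fun k => ∑ j, ‖c k‖ * k j * C :=
      summable_sum fun j _ => (hck j).mul_right C
    refine h1.of_norm_bounded fun k => ?_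
    rw [norm_smul, ← Finset.sum_mul, ← Finset.mul_sum, mul_assoc]
    gcongr
    exact hd k
  have hvd : ∀ k, v (d k) = monoProd B k - monoProd A k := fun k => hv _
  have hS : v (∑' k, c k • d k) = opFun c B - opFun c A := by
    have h1 := v.hasSum hs.hasSum
    have h2 := (hasSum_opFun hB hc).sub (hasSum_opFun hA hc)
    have e : (fun k => v (c k • d k)) = fun k => c k • monoProd B k - c k • monoProd A k :=
      funext fun k => by rw [map_smul, hvd, smul_sub]
    rw [e] at h1
    exact h1.unique h2
  obtain ⟨S, hSd⟩ : ∃ S : I.carrier, S = (∑' k, c k • d k : I.Space) := ⟨_, rfl⟩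
  rw [← hSd] at hS
  have hSv : (S : H →L[ℂ] H) = opFun c B - opFun c A := (hv S).symm.trans hS
  refine ⟨hSv ▸ S.2, ?_⟩
  have h1 := t.hasSum hs.hasSum
  have e : (fun k => t (c k • d k)) = fun k => c k * τ.ext (monoProd B k - monoProd A k) :=
    funext fun k => by
      rw [map_smul, smul_eq_mul]
      exact congrArg _ (ht ⟨_, hmem k⟩)
  rw [e, ← hSd, ht S, hSv] at h1
  exact h1

end OpFun

/-! ### Differentiating the trace along the path. -/

section TraceDerivative

variable {H : Type*} [NormedAddCommGroup H] [InnerProductSpace ℂ H] [CompleteSpace H]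
  {I : NormedIdeal H} (τ : PositiveTrace I) {n : ℕ} {A B : Fin n → H →L[ℂ] H}
  (hV : ∀ j, B j - A j ∈ I.carrier)

omit [CompleteSpace H] in
lemma linePath_zero (A B : Fin n → H →L[ℂ] H) : linePath A B 0 = A := by
  ext; simp [linePath]

omit [CompleteSpace H] in
lemma linePath_one (A B : Fin n → H →L[ℂ] H) : linePath A B 1 = B := by
  ext; simp [linePath]

omit [CompleteSpace H] in
lemma linePath_sub_linePath (A B : Fin n → H →L[ℂ] H) (s t : ℝ) (i : Fin n) :
    linePath A B s i - linePath A B t i = ((s - t : ℝ) : ℂ) • (B i - A i) := by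
  simp only [linePath]
  push_cast
  module

omit [CompleteSpace H] in
lemma differentiable_linePath (A B : Fin n → H →L[ℂ] H) (i : Fin n) :
    Differentiable ℝ fun t => linePath A B t i := by
  have : (fun t => linePath A B t i) = fun t : ℝ => A i + t • (B i - A i) := by
    ext t : 1
    simp [linePath, Complex.coe_smul]
  rw [this]
  fun_prop

omit [CompleteSpace H] in
lemma differentiable_word (A B : Fin n → H →L[ℂ] H) (w : List (Fin n)) :
    Differentiable ℝ fun t => (w.map (linePath A B t)).prod := by
  induction w with
  | nil => simp
  | cons i w ih =>
    simp only [List.map_cons, List.prod_cons]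
    exact (differentiable_linePath A B i).mul ih

omit [CompleteSpace H] in
lemma continuous_polyEval_linePath (A B : Fin n → H →L[ℂ] H) (p : MvPolynomial (Fin n) ℂ) :
    Continuous fun t => polyEval (linePath A B t) p := by
  induction p using MvPolynomial.induction_on' with
  | monomial k c =>
    simp_rw [polyEval_monomial, ← prod_map_monoWord]
    exact (differentiable_word A B _).continuous.const_smul c
  | add p q hp hq =>
    simp_rw [map_add]
    exact hp.add hq

include hV in
lemma word_sub_linePath_mem (s t : ℝ) (w : List (Fin n)) :
    (w.map (linePath A B s)).prod - (w.map (linePath A B t)).prod ∈ I.carrier :=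
  I.word_sub_mem (fun i => by
    rw [linePath_sub_linePath]; exact I.carrier.smul_mem _ (hV i)) w

/-- The derivative of the trace of a word along the path. -/
lemma hasDerivAt_ext_word {t : ℝ} (φ : MvPolynomial (Fin n) ℂ →ₐ[ℂ] (H →L[ℂ] H))
    (hφ : ∀ i, φ (MvPolynomial.X i) = linePath A B t i) (w : List (Fin n)) (T : H →L[ℂ] H)
    (hT : ∀ i, Commute (linePath A B t i) T) :
    HasDerivAt (fun s : ℝ =>
        τ.ext (((w.map (linePath A B s)).prod - (w.map (linePath A B t)).prod) * T))
      (∑ j, τ.mulLeft ⟨B j - A j, hV j⟩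
        (φ (MvPolynomial.pderiv j (w.map MvPolynomial.X).prod) * T)) t := by
  induction w generalizing T with
  | nil => simpa using hasDerivAt_const t (0 : ℂ)
  | cons i w ih =>
    -- Cyclicity moves the peeled letter X_i(t) behind T, which is why the induction runs over all T
    -- commuting with X(t). The increment appears as (s - t) τ(V_i ·), a functional continuous in
    -- the operator norm, so no derivative in the ideal norm is needed.
    have e : ∀ s : ℝ, τ.ext ((((i :: w).map (linePath A B s)).prod -
        ((i :: w).map (linePath A B t)).prod) * T) =
        ((s - t : ℝ) : ℂ) * τ.mulLeft ⟨B i - A i, hV i⟩ ((w.map (linePath A B s)).prod * T) +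
        τ.ext (((w.map (linePath A B s)).prod - (w.map (linePath A B t)).prod) *
          (T * linePath A B t i)) := by
      intro s
      rw [prod_cons_sub, add_mul, map_add, linePath_sub_linePath, smul_mul_assoc, smul_mul_assoc,
        map_smul, smul_eq_mul, PositiveTrace.mulLeft_apply, mul_assoc, mul_assoc,
        τ.ext_mul_comm (I.mul_mem_right _ T (word_sub_linePath_mem hV s t w)), mul_assoc]
    have hw : (w.map (linePath A B t)).prod = φ (w.map MvPolynomial.X).prod := by
      rw [map_list_prod, List.map_map]
      congr 2
      ext i : 1
      exact (hφ i).symm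
    have h1 : HasDerivAt (fun s : ℝ => ((s - t : ℝ) : ℂ) *
        τ.mulLeft ⟨B i - A i, hV i⟩ ((w.map (linePath A B s)).prod * T))
        (τ.mulLeft ⟨B i - A i, hV i⟩ (φ (w.map MvPolynomial.X).prod * T)) t := by
      have hg : DifferentiableAt ℝ (fun s : ℝ =>
          τ.mulLeft ⟨B i - A i, hV i⟩ ((w.map (linePath A B s)).prod * T)) t :=
        (((τ.mulLeft ⟨B i - A i, hV i⟩).restrictScalars ℝ).differentiable.comp
          ((differentiable_word A B w).mul_const T)).differentiableAt
      have hs : HasDerivAt (fun s : ℝ => ((s - t : ℝ) : ℂ)) 1 t := by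
        simpa using ((hasDerivAt_id t).sub_const t).ofReal_comp
      exact (hs.mul hg.hasDerivAt).congr_deriv (by simp [hw])
    have h2 := ih (T * linePath A B t i) fun j => (hT j).mul_right (by
      rw [← hφ, ← hφ, commute_iff_eq, ← map_mul, ← map_mul, mul_comm])
    simp_rw [e]
    refine (h1.add h2).congr_deriv ?_
    have h3 : ∀ j, τ.mulLeft ⟨B j - A j, hV j⟩ (φ (MvPolynomial.pderiv j
        ((i :: w).map MvPolynomial.X).prod) * T) =
        (if j = i then τ.mulLeft ⟨B j - A j, hV j⟩ (φ (w.map MvPolynomial.X).prod * T) else 0) +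
        τ.mulLeft ⟨B j - A j, hV j⟩ (φ (MvPolynomial.pderiv j (w.map MvPolynomial.X).prod) *
          (T * linePath A B t i)) := by
      intro j
      have h4 : φ (MvPolynomial.pderiv j (w.map MvPolynomial.X).prod) * (T * linePath A B t i) =
          φ (MvPolynomial.X i * MvPolynomial.pderiv j (w.map MvPolynomial.X).prod) * T := by
        rw [← (hT i).eq, ← mul_assoc, ← hφ, ← map_mul, mul_comm]
      rw [h4, List.map_cons, List.prod_cons, Derivation.leibniz, MvPolynomial.pderiv_X]
      rcases eq_or_ne j i with rfl | hji
      · simp [add_mul, add_comm]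
      · simp [hji, hji.symm]
    rw [Finset.sum_congr rfl fun j _ => h3 j, Finset.sum_add_distrib]
    simp

/-- The functional `p ↦ ∫₀¹ τ(V_j p(X(t))) dt` on polynomials. -/
def pathFunctional (j : Fin n) : MvPolynomial (Fin n) ℂ →ₗ[ℂ] ℂ where
  toFun p := ∫ t in (0 : ℝ)..1, τ.mulLeft ⟨B j - A j, hV j⟩ (polyEval (linePath A B t) p)
  map_add' p q := by
    simp_rw [map_add]
    refine intervalIntegral.integral_add ?_ ?_ <;>
      exact ((τ.mulLeft _).continuous.comp
        (continuous_polyEval_linePath A B _)).intervalIntegrable _ _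
  map_smul' c p := by
    simp_rw [map_smul]
    exact intervalIntegral.integral_smul c _

lemma norm_pathFunctional_le (j : Fin n) (p : MvPolynomial (Fin n) ℂ) {M : ℝ}
    (hM : ∀ t ∈ Set.Icc (0 : ℝ) 1, ‖polyEval (linePath A B t) p‖ ≤ M) :
    ‖pathFunctional τ hV j p‖ ≤ τ.varBound ⟨B j - A j, hV j⟩ * M := by
  have h := intervalIntegral.norm_integral_le_of_norm_le_const (a := (0 : ℝ)) (b := 1)
    (f := fun t => τ.mulLeft ⟨B j - A j, hV j⟩ (polyEval (linePath A B t) p))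
    (C := τ.varBound ⟨B j - A j, hV j⟩ * M) fun t ht => by
      rw [Set.uIoc_of_le zero_le_one] at ht
      refine (τ.norm_mulLeft_apply_le _ _).trans ?_
      gcongr
      · exact τ.varBound_nonneg _
      · exact hM t ⟨ht.1.le, ht.2⟩
  rw [sub_zero, abs_one, mul_one] at h
  exact h

lemma pathFunctional_one (j : Fin n) :
    pathFunctional τ hV j 1 = τ.toFun ⟨B j - A j, hV j⟩ := by
  have h : ∀ X : Fin n → H →L[ℂ] H, polyEval X 1 = 1 := fun X => by
    rw [← MvPolynomial.C_1, MvPolynomial.C_apply, polyEval_monomial, one_smul, monoProd]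
    simp
  change ∫ t in (0 : ℝ)..1, τ.mulLeft ⟨B j - A j, hV j⟩ (polyEval (linePath A B t) 1) = _
  simp [h, PositiveTrace.mulLeft_apply, τ.ext_of_mem (hV j)]

/-- This is the fundamental theorem of calculus for τ(X(t)^k - A^k), with ∂_j of a monomial equal to
k_j times the monomial of exponent k - e_j. -/
theorem ext_monoProd_sub_eq
    (hc : ∀ t ∈ Set.Icc (0 : ℝ) 1, ∀ i j, Commute (linePath A B t i) (linePath A B t j))
    (k : Fin n → ℕ) :
    τ.ext (monoProd B k - monoProd A k) = ∑ j, k j * pathFunctional τ hV j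
      (MvPolynomial.monomial (Finsupp.equivFunOnFinite.symm (lowerExp j k)) 1) := by
  let m : MvPolynomial (Fin n) ℂ := (((monoWord k).map MvPolynomial.X).prod)
  have hm : m = MvPolynomial.monomial (Finsupp.equivFunOnFinite.symm k) 1 := by
    rw [MvPolynomial.monomial_eq, map_one, one_mul, Finsupp.prod_fintype _ _ (by simp)]
    simp [m, prod_map_monoWord, monoProd_eq_prod]
  -- When k_j = 0 the truncated exponent `lowerExp j k` is k itself, which is harmless since the
  -- coefficient vanishes.
  have hpd : ∀ j, MvPolynomial.pderiv j m = (k j : ℂ) •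
      MvPolynomial.monomial (Finsupp.equivFunOnFinite.symm (lowerExp j k)) (1 : ℂ) := by
    intro j
    rw [hm, MvPolynomial.pderiv_monomial, MvPolynomial.smul_monomial]
    congr 1
    · congr 1
      ext i
      by_cases hi : i = j
      · subst hi; simp [lowerExp]
      · simp [lowerExp, hi]
    · simp
  have hderiv : ∀ t ∈ Set.uIcc (0 : ℝ) 1,
      HasDerivAt (fun s : ℝ => τ.ext (((monoWord k).map (linePath A B s)).prod -
          ((monoWord k).map (linePath A B 0)).prod))
        (∑ j, τ.mulLeft ⟨B j - A j, hV j⟩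
          (polyEval (linePath A B t) (MvPolynomial.pderiv j m))) t := by
    intro t ht
    rw [Set.uIcc_of_le zero_le_one] at ht
    obtain ⟨φ, hφ, hφ'⟩ := exists_algHom_polyEval (hc t ht)
    have h := hasDerivAt_ext_word τ hV φ hφ (monoWord k) 1 fun i => Commute.one_right _
    simp only [mul_one, hφ'] at h
    -- The word lemma subtracts the value at t itself; adding a constant moves the base point to 0,
    -- so that one function serves for all t.
    refine (h.add_const (τ.ext (((monoWord k).map (linePath A B t)).prod -
      ((monoWord k).map (linePath A B 0)).prod))).congr_of_eventuallyEq (.of_forall fun s => ?_)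
    simp only [← map_add, sub_add_sub_cancel]
  have hint := intervalIntegral.integral_eq_sub_of_hasDerivAt hderiv (by
    refine Continuous.intervalIntegrable ?_ _ _
    exact continuous_finsetSum _ fun j _ => (τ.mulLeft _).continuous.comp
      (continuous_polyEval_linePath A B _))
  rw [linePath_one, linePath_zero, sub_self, map_zero, sub_zero, prod_map_monoWord,
    prod_map_monoWord] at hint
  have hi : ∀ j ∈ Finset.univ, IntervalIntegrable (fun t => τ.mulLeft ⟨B j - A j, hV j⟩
      (polyEval (linePath A B t) (MvPolynomial.pderiv j m))) volume 0 1 := fun j _ =>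
    ((τ.mulLeft _).continuous.comp (continuous_polyEval_linePath A B _)).intervalIntegrable _ _
  rw [← hint, intervalIntegral.integral_finsetSum hi]
  refine Finset.sum_congr rfl fun j _ => ?_
  change pathFunctional τ hV j _ = _
  rw [hpd, map_smul, smul_eq_mul]

end TraceDerivative

end OpTrace
end

noncomputable section

namespace OpTrace

/-! ### Representing measures and the trace formula. -/

section Representation

variable {n : ℕ} {𝕜 : Type*} [RCLike 𝕜] [NormedAlgebra 𝕜 ℂ] [MeasurableSpace 𝕜]
  {s : Set 𝕜} {F : Type*} [NormedAddCommGroup F] [NormedSpace ℝ F]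

/-- The coordinates of `sⁿ`. -/
def coordC (s : Set 𝕜) (n : ℕ) : C(Fin n → s, Fin n → 𝕜) := ⟨fun z i => z i, by fun_prop⟩

/-- Integration against `μ` is a bounded functional on continuous functions that extends the
functional `Λ` on polynomials. -/
structure Represents [CompactSpace s] (Λ : MvPolynomial (Fin n) ℂ →ₗ[ℂ] ℂ)
    (P : ℂ →L[ℝ] F →L[ℝ] ℂ) (μ : VectorMeasure (Fin n → s) F) : Prop where
  finite : IsFiniteMeasure μ.variation
  exists_functional : ∃ J : C(Fin n → s, ℂ) →L[ℂ] ℂ, (∀ g : C(Fin n → s, ℂ), μ.integral g P = J g) ∧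
    ∀ k, J (monoC (coordC s n) k) =
      Λ (MvPolynomial.monomial (Finsupp.equivFunOnFinite.symm k) 1)

/-- The pairing P covers complex measures (multiplication) and signed measures (scalar action)
alike; `hP` makes the resulting functional complex linear. The map ι carries a measure on a smaller
compact space into the cube. -/
lemma Represents.of_density [BorelSpace 𝕜] [SecondCountableTopology 𝕜] [CompactSpace s]
    [CompleteSpace F] {Y : Type*} [TopologicalSpace Y] [CompactSpace Y]
    [MeasurableSpace Y] [BorelSpace Y] {m : Measure Y} {d : Y → F} (hd : Integrable d m)
    (hfin : IsFiniteMeasure (m.withDensityᵥ d).variation) {P : ℂ →L[ℝ] F →L[ℝ] ℂ}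
    (hP : ∀ (a z : ℂ) x, P (a * z) x = a * P z x) (ι : C(Y, Fin n → s))
    {Λ : MvPolynomial (Fin n) ℂ →ₗ[ℂ] ℂ}
    (hΛ : ∀ k, ∫ y, P (monoC (coordC s n) k (ι y)) (d y) ∂m =
      Λ (MvPolynomial.monomial (Finsupp.equivFunOnFinite.symm k) 1)) :
    Represents Λ P ((m.withDensityᵥ d).map ι) := by
  have hC : ∀ (g : C(Fin n → s, ℂ)) y, ‖g (ι y)‖ ≤ ‖g‖ := fun g y => g.norm_coe_le_norm _
  have hm : ∀ g : C(Fin n → s, ℂ), StronglyMeasurable fun y => g (ι y) := fun g =>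
    (g.comp ι).continuous.stronglyMeasurable
  have hi : ∀ g : C(Fin n → s, ℂ), Integrable (fun y => P (g (ι y)) (d y)) m := fun g =>
    integrable_apply_density hd P (hm g) (hC g)
  let J : C(Fin n → s, ℂ) →ₗ[ℂ] ℂ :=
    { toFun := fun g => ∫ y, P (g (ι y)) (d y) ∂m
      map_add' := fun f g => by
        rw [← integral_add (hi f) (hi g)]
        simp
      map_smul' := fun a g => by
        rw [RingHom.id_apply, smul_eq_mul, ← integral_const_mul]
        simp [hP] }
  refine ⟨inferInstance, J.mkContinuous (‖P‖ * ∫ y, ‖d y‖ ∂m) fun g => ?_, fun g => ?_, hΛ⟩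
  · refine (norm_integral_le_of_norm_le ((hd.norm.const_mul (‖P‖ * ‖g‖)))
      (.of_forall fun y => ?_)).trans_eq (by rw [integral_const_mul]; ring)
    refine (P.le_opNorm₂ _ _).trans ?_
    gcongr
    exact hC g y
  · rw [VectorMeasure.integral_map ι.continuous.measurable
      g.continuous.stronglyMeasurable.aestronglyMeasurable
      ((integrable_const ‖g‖).mono' (hm g).aestronglyMeasurable (.of_forall (hC g))),
      integral_withDensityᵥ hd P (hm g) (hC g)]
    rfl

end Representation

section TraceFormula

variable {H : Type*} [NormedAddCommGroup H] [InnerProductSpace ℂ H] [CompleteSpace H]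
  {I : NormedIdeal H} {τ : PositiveTrace I} {n : ℕ} {A B : Fin n → H →L[ℂ] H}
  {hV : ∀ j, B j - A j ∈ I.carrier}
  {𝕜 : Type*} [RCLike 𝕜] [NormedAlgebra 𝕜 ℂ] [MeasurableSpace 𝕜] {s : Set 𝕜} [CompactSpace s]
  {F : Type*} [NormedAddCommGroup F] [NormedSpace ℝ F]
  {P : ℂ →L[ℝ] F →L[ℝ] ℂ} {μ : Fin n → VectorMeasure (Fin n → s) F}

/-- Both sides are sums over k with equal terms: on the left the series converges in the ideal, on
the right ∂_j f converges uniformly, and there integration is a bounded functional. -/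
theorem trace_formula (hA : ∀ i, ‖A i‖ ≤ 1) (hB : ∀ i, ‖B i‖ ≤ 1)
    (hc : ∀ t ∈ Set.Icc (0 : ℝ) 1, ∀ i j, Commute (linePath A B t i) (linePath A B t j))
    (hs : ∀ x ∈ s, ‖x‖ ≤ 1) (hμ : ∀ j, Represents (pathFunctional τ hV j) P (μ j))
    {ε : ℝ} (hε : 0 < ε) {f : (Fin n → 𝕜) → ℂ} {c : (Fin n → ℕ) → ℂ} (hf : HasTaylor ε f c) :
    ∃ h : opFun c B - opFun c A ∈ I.carrier,
      τ.toFun ⟨opFun c B - opFun c A, h⟩ =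
        ∑ j, (μ j).integral (fun z => partialD j f fun i => (z i : 𝕜)) P := by
  obtain ⟨h, hsum⟩ := opFun_sub_mem_and_hasSum τ hA hB hV (hf.summable_norm hε)
    fun j => hf.summable_norm_mul hε j
  refine ⟨h, ?_⟩
  rw [← τ.ext_of_mem h]
  choose J hJ hJm using fun j => (hμ j).exists_functional
  choose G hG hGs using fun j => hf.exists_hasSum_monoC (coordC s n) hε
    (fun y i => hs _ (y i).2) j
  have h1 : ∀ j, (μ j).integral (fun z => partialD j f fun i => (z i : 𝕜)) P = J j (G j) :=
    fun j => by
      rw [← hJ]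
      exact congrArg (fun g => (μ j).integral g P) (funext fun z => (hG j z).symm)
  rw [Finset.sum_congr rfl fun j _ => h1 j]
  refine hsum.unique ?_
  have h2 := hasSum_sum fun j (_ : j ∈ Finset.univ) => (J j).hasSum (hGs j)
  convert h2 using 2 with k
  rw [ext_monoProd_sub_eq τ hV hc k, Finset.mul_sum]
  refine Finset.sum_congr rfl fun j _ => ?_
  rw [map_smul, hJm, smul_eq_mul, mul_assoc]

omit [CompleteSpace H] in
lemma monoProd_pi_single {X : Fin n → H →L[ℂ] H} (hX : ∀ i j, Commute (X i) (X j)) (j : Fin n)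
    (m : ℕ) : monoProd X (Pi.single j m : Fin n → ℕ) = X j ^ m := by
  obtain ⟨φ, hφ, -⟩ := exists_algHom_polyEval hX
  have h : X = fun i => φ (MvPolynomial.X i) := funext fun i => (hφ i).symm
  rw [← hφ j, ← map_pow]
  conv_lhs => rw [h]
  rw [← map_monoProd, monoProd_eq_prod, Finset.prod_eq_single j]
  · simp
  · intro i _ hi
    simp [hi]
  · simp

omit [CompleteSpace H] in
lemma opFun_extend_single {X : Fin n → H →L[ℂ] H} (hX : ∀ i j, Commute (X i) (X j)) (j : Fin n)
    (c : ℕ → ℂ) :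
    opFun (Function.extend (fun m => (Pi.single j m : Fin n → ℕ)) c 0) X = opFunOne c (X j) := by
  have hinj : Function.Injective fun m : ℕ => (Pi.single j m : Fin n → ℕ) :=
    Pi.single_injective (M := fun _ => ℕ) j
  change ∑' k, Function.extend (fun m => (Pi.single j m : Fin n → ℕ)) c 0 k • monoProd X k = _
  rw [← hinj.tsum_eq]
  · refine tsum_congr fun m => ?_
    rw [hinj.extend_apply, monoProd_pi_single hX]
  · intro k hk
    by_contra h
    exact hk (by
      change Function.extend (fun m => (Pi.single j m : Fin n → ℕ)) c 0 k • monoProd X k = 0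
      rw [Function.extend_apply' _ _ _ (by simpa using h), Pi.zero_apply, zero_smul])

theorem trace_formula_one (hA : IsCommutingContractions A) (hB : IsCommutingContractions B)
    (hc : ∀ t ∈ Set.Icc (0 : ℝ) 1, ∀ i j, Commute (linePath A B t i) (linePath A B t j))
    (hs : ∀ x ∈ s, ‖x‖ ≤ 1) (hμ : ∀ j, Represents (pathFunctional τ hV j) P (μ j))
    (j : Fin n) {ε : ℝ} (hε : 0 < ε) {f : 𝕜 → ℂ} {c : ℕ → ℂ} (hf : HasTaylorOne ε f c) :
    ∃ h : opFunOne c (B j) - opFunOne c (A j) ∈ I.carrier,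
      τ.toFun ⟨opFunOne c (B j) - opFunOne c (A j), h⟩ =
        (μ j).integral (fun z => deriv f (z j : 𝕜)) P := by
  have h := trace_formula hA.1 hB.1 hc hs hμ hε (hf.comp_apply j)
  simp only [opFun_extend_single hA.2, opFun_extend_single hB.2] at h
  obtain ⟨h1, h2⟩ := h
  refine ⟨h1, h2.trans ?_⟩
  rw [Finset.sum_eq_single j]
  · simp_rw [partialD_comp_apply_self]
  · intro i _ hi
    simp_rw [partialD_comp_apply_of_ne f (Ne.symm hi)]
    exact VectorMeasure.integral_zero
  · simp

/-- The image of `μ_j` under the `j`-th coordinate satisfies the one-variable trace formula. -/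
theorem trace_formula_map [BorelSpace 𝕜] [SecondCountableTopology 𝕜]
    (hA : IsCommutingContractions A) (hB : IsCommutingContractions B)
    (hc : ∀ t ∈ Set.Icc (0 : ℝ) 1, ∀ i j, Commute (linePath A B t i) (linePath A B t j))
    (hs : ∀ x ∈ s, ‖x‖ ≤ 1) (hμ : ∀ j, Represents (pathFunctional τ hV j) P (μ j))
    (j : Fin n) {ε : ℝ} (hε : 0 < ε) {f : 𝕜 → ℂ} {c : ℕ → ℂ} (hf : HasTaylorOne ε f c) :
    ∃ h : opFunOne c (B j) - opFunOne c (A j) ∈ I.carrier,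
      τ.toFun ⟨opFunOne c (B j) - opFunOne c (A j), h⟩ =
        ((μ j).map fun z => z j).integral (fun z => deriv f (z : 𝕜)) P := by
  obtain ⟨h1, h2⟩ := trace_formula_one hA hB hc hs hμ j hε hf
  refine ⟨h1, h2.trans ?_⟩
  obtain ⟨G, hG, -⟩ := (hf.comp_apply (n := 1) 0).exists_hasSum_monoC
    (e := ⟨fun (x : s) (_ : Fin 1) => (x : 𝕜), by fun_prop⟩) hε (fun y _ => hs _ y.2) 0
  have hG' : ∀ x : s, G x = deriv f (x : 𝕜) := fun x => by
    rw [hG, partialD_comp_apply_self]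
    rfl
  simp_rw [← hG']
  have := (hμ j).finite
  refine (VectorMeasure.integral_map (measurable_pi_apply j)
    G.continuous.stronglyMeasurable.aestronglyMeasurable ?_).symm
  exact (integrable_const ‖G‖).mono'
    (G.continuous.stronglyMeasurable.comp_measurable (measurable_pi_apply j)).aestronglyMeasurable
    (.of_forall fun z => G.norm_coe_le_norm _)

/-- Integrals of functions of one coordinate are determined by the one-variable trace formula. -/
theorem integral_eq_of_trace_formula_one (hA : IsCommutingContractions A)
    (hB : IsCommutingContractions B)
    (hc : ∀ t ∈ Set.Icc (0 : ℝ) 1, ∀ i j, Commute (linePath A B t i) (linePath A B t j))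
    (hs : ∀ x ∈ s, ‖x‖ ≤ 1) (hμ : ∀ j, Represents (pathFunctional τ hV j) P (μ j))
    (j : Fin n) {ν : VectorMeasure s F}
    (hν : ∀ ε : ℝ, 0 < ε → ∀ (f : 𝕜 → ℂ) (c : ℕ → ℂ), HasTaylorOne ε f c →
      ∃ h : opFunOne c (B j) - opFunOne c (A j) ∈ I.carrier,
        τ.toFun ⟨opFunOne c (B j) - opFunOne c (A j), h⟩ =
          ν.integral (fun z => deriv f (z : 𝕜)) P)
    {ε : ℝ} (hε : 0 < ε) {g : 𝕜 → ℂ} {c : ℕ → ℂ} (hg : HasTaylorOne ε g c) :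
    (μ j).integral (fun z => g (z j : 𝕜)) P = ν.integral (fun z => g (z : 𝕜)) P := by
  obtain ⟨G, c', hG, hd⟩ := hg.exists_antideriv
  have hd' : ∀ x : s, deriv G (x : 𝕜) = g x := fun x =>
    hd _ ((hs _ x.2).trans_lt (by linarith))
  obtain ⟨_, h1⟩ := trace_formula_one hA hB hc hs hμ j hε hG
  obtain ⟨_, h2⟩ := hν ε hε G c' hG
  simp_rw [hd'] at h1 h2
  exact h1.symm.trans h2

end TraceFormula

/-! ### Existence of representing measures on the torus and on the cube. -/

section Existence

variable {n : ℕ}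

lemma exists_density_of_polynomial_bound {𝕜 : Type*} [RCLike 𝕜] {Y : Type*} [TopologicalSpace Y]
    [CompactSpace Y] [T2Space Y] [MeasurableSpace Y] [BorelSpace Y] (u : Fin n → C(Y, 𝕜))
    (Φ : MvPolynomial (Fin n) 𝕜 →ₗ[𝕜] 𝕜) {C : ℝ} (hC : 0 ≤ C)
    (h : ∀ p (M : ℝ), 0 ≤ M → (∀ y, ‖MvPolynomial.eval (fun i => u i y) p‖ ≤ M) →
      ‖Φ p‖ ≤ C * M) :
    ∃ (m : Measure Y) (d : Y → 𝕜), IsFiniteMeasure m ∧ Integrable d m ∧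
      (m.withDensityᵥ d).variation Set.univ ≤ ENNReal.ofReal C ∧
      ∀ p, ∫ y, MvPolynomial.eval (fun i => u i y) p * d y ∂m = Φ p := by
  let S : MvPolynomial (Fin n) 𝕜 →ₐ[𝕜] C(Y, 𝕜) := MvPolynomial.aeval u
  have hS : ∀ p y, S p y = MvPolynomial.eval (fun i => u i y) p := by
    intro p y
    induction p using MvPolynomial.induction_on with
    | C a => simp [S]
    | add p q hp hq => rw [map_add, map_add, ContinuousMap.add_apply, hp, hq]
    | mul_X p i hp =>
      rw [map_mul, map_mul, ContinuousMap.mul_apply, hp, MvPolynomial.eval_X,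
        MvPolynomial.aeval_X]
  obtain ⟨φ, hφ, hφC⟩ := exists_dual_comp_eq S.toLinearMap Φ hC fun p =>
    h p _ (norm_nonneg _) fun y => by
      rw [← hS]
      exact (S p).norm_coe_le_norm y
  obtain ⟨m, d, hm, hd, hv, hi⟩ := exists_density_of_dual φ
  refine ⟨m, d, hm, hd, hv.trans (ENNReal.ofReal_le_ofReal hφC), fun p => ?_⟩
  rw [← hφ p, ← hi]
  exact integral_congr_ae (.of_forall fun y => congrArg (· * d y) (hS p y).symm)

lemma variation_map_univ_le {X Y F : Type*} [MeasurableSpace X] [MeasurableSpace Y]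
    [NormedAddCommGroup F] (μ : VectorMeasure X F) {f : X → Y} (hf : Measurable f) :
    (μ.map f).variation Set.univ ≤ μ.variation Set.univ :=
  (VectorMeasure.variation_map_le _).trans_eq (by rw [Measure.map_apply hf .univ]; rfl)

lemma map_univ_withDensityᵥ {X Y F : Type*} [MeasurableSpace X] [MeasurableSpace Y]
    [NormedAddCommGroup F] [NormedSpace ℝ F] {m : Measure X} {d : X → F} (hd : Integrable d m)
    {f : X → Y} (hf : Measurable f) :
    (m.withDensityᵥ d).map f Set.univ = ∫ x, d x ∂m := by
  rw [VectorMeasure.map_apply _ hf .univ, Set.preimage_univ, withDensityᵥ_apply hd .univ,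
    Measure.restrict_univ]

theorem exists_circle_represents (Λ : MvPolynomial (Fin n) ℂ →ₗ[ℂ] ℂ) {C : ℝ} (hC : 0 ≤ C)
    (h : ∀ p (M : ℝ), 0 ≤ M →
      (∀ z : Fin n → ℂ, (∀ i, ‖z i‖ = 1) → ‖MvPolynomial.eval z p‖ ≤ M) → ‖Λ p‖ ≤ C * M) :
    ∃ μ : ComplexMeasure (Fin n → UnitCircle), μ.variation Set.univ ≤ ENNReal.ofReal C ∧
      μ Set.univ = Λ 1 ∧ Represents Λ (ContinuousLinearMap.mul ℝ ℂ) μ := by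
  obtain ⟨m, d, hm, hd, hv, hi⟩ := exists_density_of_polynomial_bound
    (Y := Fin n → UnitCircle) (fun i => ⟨fun z => (z i : ℂ), by fun_prop⟩) Λ hC
    fun p M hM hp => h p M hM fun z hz => hp fun i => ⟨z i, by simp [hz]⟩
  have hfin : IsFiniteMeasure (m.withDensityᵥ d).variation :=
    ⟨hv.trans_lt ENNReal.ofReal_lt_top⟩
  have hid : Measurable (ContinuousMap.id (Fin n → UnitCircle)) := measurable_id
  -- The push-forward along the identity only serves to match the form of `Represents.of_density`.
  refine ⟨(m.withDensityᵥ d).map (ContinuousMap.id _), (variation_map_univ_le _ hid).trans hv,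
    ?_, .of_density hd hfin (fun a z x => mul_assoc a z x) _ fun k => ?_⟩
  · rw [map_univ_withDensityᵥ hd hid, ← hi]
    simp
  · rw [← hi]
    refine integral_congr_ae (.of_forall fun z => congrArg (· * d z) ?_)
    simp [monoC, coordC, MvPolynomial.eval_monomial, Finsupp.prod_fintype]

/-- By `hre`, Λ restricts to a real functional on real polynomials, so its density is real. The
measure is built on ∏ L_i before being pushed into the cube, hence its marginals are carried by the
sets L_j. -/
theorem exists_interval_represents (Λ : MvPolynomial (Fin n) ℂ →ₗ[ℂ] ℂ) {C : ℝ} (hC : 0 ≤ C)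
    {L : Fin n → Set ℝ} (hL : ∀ i, IsCompact (L i)) (hL1 : ∀ i, L i ⊆ Set.Icc (-1) 1)
    (hre : ∀ p : MvPolynomial (Fin n) ℝ, (Λ (MvPolynomial.map Complex.ofRealHom p)).im = 0)
    (h : ∀ p (M : ℝ), 0 ≤ M →
      (∀ x : Fin n → ℝ, (∀ i, x i ∈ L i) → ‖MvPolynomial.eval (fun i => (x i : ℂ)) p‖ ≤ M) →
      ‖Λ p‖ ≤ C * M) :
    ∃ μ : SignedMeasure (Fin n → UnitInterval), μ.variation Set.univ ≤ ENNReal.ofReal C ∧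
      ((μ Set.univ : ℝ) : ℂ) = Λ 1 ∧
      Represents Λ (ContinuousLinearMap.lsmul ℝ ℝ).flip μ ∧
      ∀ j, (μ.map fun x => x j).variation {x | (x : ℝ) ∉ L j} = 0 := by
  have hcomp : ∀ i, CompactSpace (L i) := fun i => isCompact_iff_compactSpace.1 (hL i)
  let Φ : MvPolynomial (Fin n) ℝ →ₗ[ℝ] ℝ :=
    { toFun := fun p => (Λ (MvPolynomial.map Complex.ofRealHom p)).re
      map_add' := fun p q => by simp
      map_smul' := fun a p => by
        rw [MvPolynomial.smul_eq_C_mul, map_mul, MvPolynomial.map_C, ← MvPolynomial.smul_eq_C_mul,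
          map_smul]
        simp }
  have hΦ : ∀ p, (Φ p : ℂ) = Λ (MvPolynomial.map Complex.ofRealHom p) := fun p =>
    Complex.ext rfl (hre p).symm
  have hev : ∀ (p : MvPolynomial (Fin n) ℝ) (x : Fin n → ℝ),
      MvPolynomial.eval (fun i => (x i : ℂ)) (MvPolynomial.map Complex.ofRealHom p) =
        (MvPolynomial.eval x p : ℝ) := fun p x => by
    rw [MvPolynomial.eval_map]
    exact (MvPolynomial.eval₂_comp Complex.ofRealHom x p).symm
  obtain ⟨m, d, hm, hd, hv, hi⟩ := exists_density_of_polynomial_bound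
    (Y := ∀ i, L i) (fun i => ⟨fun z => (z i : ℝ), by fun_prop⟩) Φ hC
    fun p M hM hp => by
      have h1 := h (MvPolynomial.map Complex.ofRealHom p) M hM fun x hx => by
        rw [hev, Complex.norm_real]
        exact hp fun i => ⟨x i, hx i⟩
      rwa [← hΦ, Complex.norm_real] at h1
  have hfin : IsFiniteMeasure (m.withDensityᵥ d).variation :=
    ⟨hv.trans_lt ENNReal.ofReal_lt_top⟩
  let ι : C(∀ i, L i, Fin n → UnitInterval) := ⟨fun z i => ⟨z i, hL1 i (z i).2⟩, by fun_prop⟩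
  have hι : Measurable ι := ι.continuous.measurable
  refine ⟨(m.withDensityᵥ d).map ι, (variation_map_univ_le _ hι).trans hv,
    ?_, .of_density hd hfin (fun a z x => ?_) _ fun k => ?_, fun j => ?_⟩
  · rw [map_univ_withDensityᵥ hd hι]
    have h1 := hΦ 1
    rw [← hi, map_one (MvPolynomial.map Complex.ofRealHom)] at h1
    rw [← h1]
    simp
  · simp only [ContinuousLinearMap.flip_apply, ContinuousLinearMap.lsmul_apply, mul_smul_comm]
  · have h1 := hΦ (MvPolynomial.monomial (Finsupp.equivFunOnFinite.symm k) 1)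
    rw [MvPolynomial.map_monomial, map_one Complex.ofRealHom] at h1
    rw [← h1, ← hi, ← integral_complex_ofReal]
    refine integral_congr_ae (.of_forall fun z => ?_)
    simp [monoC, coordC, MvPolynomial.eval_monomial, Finsupp.prod_fintype, ι, mul_comm]
  · have hj : Measurable fun x : Fin n → UnitInterval => x j := measurable_pi_apply j
    have hs : MeasurableSet {x : UnitInterval | (x : ℝ) ∉ L j} :=
      ((hL j).isClosed.measurableSet.preimage measurable_subtype_coe).compl
    refine le_antisymm ((VectorMeasure.variation_map_le _).trans ?_) zero_le
    rw [Measure.map_apply hj hs]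
    refine (VectorMeasure.variation_map_le _).trans ?_
    rw [Measure.map_apply hι (hj hs)]
    have he : ι ⁻¹' ((fun x => x j) ⁻¹' {x : UnitInterval | (x : ℝ) ∉ L j}) = ∅ :=
      Set.eq_empty_of_forall_notMem fun z hz => hz (z j).2
    rw [he, measure_empty]

end Existence

/-! ### Reality of the path functional in the self-adjoint case. -/

section SelfAdjoint

variable {H : Type*} [NormedAddCommGroup H] [InnerProductSpace ℂ H] [CompleteSpace H]
  {n : ℕ}

lemma isSelfAdjoint_polyEval_map {X : Fin n → H →L[ℂ] H} (hX : ∀ i j, Commute (X i) (X j))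
    (hsa : ∀ i, IsSelfAdjoint (X i)) (p : MvPolynomial (Fin n) ℝ) :
    IsSelfAdjoint (polyEval X (MvPolynomial.map Complex.ofRealHom p)) := by
  obtain ⟨φ, hφ, hφ'⟩ := exists_algHom_polyEval hX
  rw [← hφ']
  induction p using MvPolynomial.induction_on with
  | C a =>
    rw [MvPolynomial.map_C, ← MvPolynomial.algebraMap_eq, AlgHom.commutes,
      Algebra.algebraMap_eq_smul_one]
    exact IsSelfAdjoint.smul (Complex.conj_ofReal a) (.one _)
  | add p q hp hq =>
    rw [map_add, map_add]
    exact hp.add hq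
  | mul_X p i hp =>
    rw [map_mul, map_mul, MvPolynomial.map_X]
    refine (hp.commute_iff (hφ i ▸ hsa i)).1 ?_
    rw [commute_iff_eq, ← map_mul, ← map_mul, mul_comm]

lemma im_intervalIntegral_eq_zero {F : ℝ → ℂ} (hF : ∀ t ∈ Set.Icc (0 : ℝ) 1, (F t).im = 0) :
    (∫ t in (0 : ℝ)..1, F t).im = 0 := by
  have h : ∫ t in (0 : ℝ)..1, F t = ∫ t in (0 : ℝ)..1, ((F t).re : ℂ) := by
    refine intervalIntegral.integral_congr fun t ht => ?_
    rw [Set.uIcc_of_le zero_le_one] at ht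
    exact Complex.ext (Complex.ofReal_re _).symm ((hF t ht).trans (Complex.ofReal_im _).symm)
  rw [h, intervalIntegral.integral_ofReal, Complex.ofReal_im]

lemma pathFunctional_map_im_eq_zero {I : NormedIdeal H} (τ : PositiveTrace I)
    {A B : Fin n → H →L[ℂ] H} (hV : ∀ j, B j - A j ∈ I.carrier) (hA : ∀ j, IsSelfAdjoint (A j))
    (hB : ∀ j, IsSelfAdjoint (B j))
    (hc : ∀ t ∈ Set.Icc (0 : ℝ) 1, ∀ i j, Commute (linePath A B t i) (linePath A B t j))
    (j : Fin n) (p : MvPolynomial (Fin n) ℝ) :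
    (pathFunctional τ hV j (MvPolynomial.map Complex.ofRealHom p)).im = 0 := by
  refine im_intervalIntegral_eq_zero fun t ht => ?_
  have hV' : IsSelfAdjoint (B j - A j) := (hB j).sub (hA j)
  have hT := isSelfAdjoint_polyEval_map (hc t ht) (isSelfAdjoint_linePath hA hB t) p
  exact τ.mulLeft_im_eq_zero (V := ⟨B j - A j, hV j⟩) hV' hT

end SelfAdjoint

end OpTrace
end

/-! ### The main theorem. -/

theorem mainTheorem1 {H : Type*} [NormedAddCommGroup H] [InnerProductSpace ℂ H] [CompleteSpace H]
    [TopologicalSpace.SeparableSpace H]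
    (I : OpTrace.NormedIdeal H) (τ : OpTrace.PositiveTrace I)
    {n : ℕ} (A B : Fin n → H →L[ℂ] H)
    (hA : OpTrace.IsCommutingContractions A) (hB : OpTrace.IsCommutingContractions B)
    (hV : ∀ j, B j - A j ∈ I.carrier)
    (hcomm : ∀ i j, i ≠ j → Commute (B i - A i) (B j - A j))
    (hN : OpTrace.PathDilates A B) :
    (∃ μ : Fin n → ComplexMeasure (Fin n → OpTrace.UnitCircle),
      (∀ j, OpTrace.VariationBound τ ⟨B j - A j, hV j⟩ (μ j)) ∧
      (∀ j, μ j Set.univ = τ.toFun ⟨B j - A j, hV j⟩) ∧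
      (∀ ε : ℝ, 0 < ε → ∀ (f : (Fin n → ℂ) → ℂ) (c : (Fin n → ℕ) → ℂ), OpTrace.HasTaylor ε f c →
        ∃ h : OpTrace.opFun c B - OpTrace.opFun c A ∈ I.carrier,
          τ.toFun ⟨OpTrace.opFun c B - OpTrace.opFun c A, h⟩ =
            ∑ j, ∫ᵛ z, OpTrace.partialD j f (fun i => (z i : ℂ))
              ∂[ContinuousLinearMap.mul ℝ ℂ; μ j]) ∧
      (∀ j, OpTrace.IsCircleMeasureFor τ (A j) (B j) (hV j) ((μ j).map fun z => z j)) ∧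
      (∀ j, ∀ ν : ComplexMeasure OpTrace.UnitCircle,
        OpTrace.IsCircleMeasureFor τ (A j) (B j) (hV j) ν →
        ∀ ε : ℝ, 0 < ε → ∀ (g : ℂ → ℂ) (c : ℕ → ℂ), OpTrace.HasTaylorOne ε g c →
          ∫ᵛ z, g (z j : ℂ) ∂[ContinuousLinearMap.mul ℝ ℂ; μ j] =
            ∫ᵛ z, g (z : ℂ) ∂[ContinuousLinearMap.mul ℝ ℂ; ν])) ∧
    ((∀ j, IsSelfAdjoint (A j)) → (∀ j, IsSelfAdjoint (B j)) →
      ∃ μ : Fin n → SignedMeasure (Fin n → OpTrace.UnitInterval),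
        (∀ j, OpTrace.VariationBound τ ⟨B j - A j, hV j⟩ (μ j)) ∧
        (∀ j, ((μ j Set.univ : ℝ) : ℂ) = τ.toFun ⟨B j - A j, hV j⟩) ∧
        (∀ ε : ℝ, 0 < ε → ∀ (f : (Fin n → ℝ) → ℂ) (c : (Fin n → ℕ) → ℂ),
          OpTrace.HasTaylor ε f c →
          ∃ h : OpTrace.opFun c B - OpTrace.opFun c A ∈ I.carrier,
            τ.toFun ⟨OpTrace.opFun c B - OpTrace.opFun c A, h⟩ =
              ∑ j, ∫ᵛ x, OpTrace.partialD j f (fun i => (x i : ℝ)) ∂<•(μ j)) ∧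
        (∀ j, OpTrace.IsIntervalMeasureFor τ (A j) (B j) ((μ j).map fun x => x j)) ∧
        (∀ j, ∀ ν : SignedMeasure OpTrace.UnitInterval,
          OpTrace.IsIntervalMeasureFor τ (A j) (B j) ν →
          ∀ ε : ℝ, 0 < ε → ∀ (g : ℝ → ℂ) (c : ℕ → ℂ), OpTrace.HasTaylorOne ε g c →
            ∫ᵛ x, g (x j : ℝ) ∂<•(μ j) = ∫ᵛ x, g (x : ℝ) ∂<•ν)) := by
  have hc : ∀ t ∈ Set.Icc (0 : ℝ) 1, ∀ i j,
      Commute (OpTrace.linePath A B t i) (OpTrace.linePath A B t j) := fun t ht => (hN t ht).1.2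
  constructor
  · have hs : ∀ x ∈ Metric.sphere (0 : ℂ) 1, ‖x‖ ≤ 1 := fun x hx =>
      (mem_sphere_zero_iff_norm.1 hx).le
    choose μ hμv hμ1 hμ using fun j => OpTrace.exists_circle_represents
      (OpTrace.pathFunctional τ hV j) (τ.varBound_nonneg ⟨B j - A j, hV j⟩) fun p M hM hp =>
        OpTrace.norm_pathFunctional_le τ hV j p fun t ht => (hN t ht).2.norm_polyEval_le p hM hp
    refine ⟨μ, fun j => τ.variationBound_of_le _ (hμv j), fun j => ?_, fun ε hε f c hf =>
      OpTrace.trace_formula hA.1 hB.1 hc hs hμ hε hf, fun j => ⟨?_, fun ε hε f c hf =>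
        OpTrace.trace_formula_map hA hB hc hs hμ j hε hf⟩, fun j ν hν ε hε g c hg =>
      OpTrace.integral_eq_of_trace_formula_one hA hB hc hs hμ j hν.2 hε hg⟩
    · rw [hμ1, OpTrace.pathFunctional_one]
    · exact τ.variationBound_of_le _
        ((OpTrace.variation_map_univ_le _ (measurable_pi_apply j)).trans (hμv j))
  · intro hAs hBs
    have hs : ∀ x ∈ Set.Icc (-1 : ℝ) 1, ‖x‖ ≤ 1 := fun x hx => abs_le.2 hx
    choose μ hμv hμ1 hμ hμs using fun j => OpTrace.exists_interval_represents
      (OpTrace.pathFunctional τ hV j) (τ.varBound_nonneg ⟨B j - A j, hV j⟩)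
      (fun i => OpTrace.isCompact_specHull (A i) (B i))
      (fun i => OpTrace.specHull_subset_Icc (hA.1 i) (hB.1 i))
      (OpTrace.pathFunctional_map_im_eq_zero τ hV hAs hBs hc j) fun p M hM hp =>
        OpTrace.norm_pathFunctional_le τ hV j p fun t ht =>
          OpTrace.norm_polyEval_linePath_le_of_isSelfAdjoint hAs hBs ht (hc t ht) p hM hp
    refine ⟨μ, fun j => τ.variationBound_of_le _ (hμv j), fun j => ?_, fun ε hε f c hf =>
      OpTrace.trace_formula hA.1 hB.1 hc hs hμ hε hf, fun j => ⟨hμs j j, fun ε hε f c hf =>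
        OpTrace.trace_formula_map hA hB hc hs hμ j hε hf⟩, fun j ν hν ε hε g c hg =>
      OpTrace.integral_eq_of_trace_formula_one hA hB hc hs hμ j hν.2 hε hg⟩
    rw [hμ1, OpTrace.pathFunctional_one]
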